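/- Let $n>1$, let $k$ be a field of characteristic $0$ containing a primitive $n$-th root of unity $\zeta$, and let $H_n$ be the Taft Hopf algebra: the $k$-algebra with generators $K,X$ and relations $KX=\zeta XK$, $K^n=1$, $X^n=0$, with comultiplication $\Delta(K)=K\otimes K$, $\Delta(X)=X\otimes 1+K\otimes X$, counit $\epsilon(K)=1$, $\epsilon(X)=0$, and antipode $S(K)=K^{-1}$, $S(X)=-K^{-1}X$. Let $\Lambda\in H_n$ be any left integral, that is, a nonzero element with $h\Lambda=\epsilon(h)\Lambda$ for all $h\in H_n$. Let $H_n\text{-}\underline{\mathrm{mod}}$ be the stable category of finite-dimensional left $H_n$-modules, that is, the category of these modules with homomorphisms taken modulo those that factor through a projective (equivalently, injective) module. Put $TM=(H_n/k\Lambda)\otimes M$. For a module homomorphism $u\colon X\to Y$ let $C_u$ be the pushout of $u$ and of $X\to H_n\otimes X$, $x\mapsto\Lambda\otimes x$; the distinguished triangles are those isomorphic in $H_n\text{-}\underline{\mathrm{mod}}$ to a standard triangle $X\xrightarrow{u} Y\to C_u\to TX$. Let $K(H_n\text{-}\underline{\mathrm{mod}})$ be the Grothendieck group: the abelian group with generators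 $[X]$ for all objects $X$ and relations $[Y]=[X]+[Z]$ for all distinguished triangles $X\to Y\to Z\to TX$. Then $K(H_n\text{-}\underline{\mathrm{mod}})$ has a unique ring structure with the given addition in which $[M][N]=[M\otimes N]$ for all finite-dimensional modules $M,N$ and $1$ is the class of the trivial module $k$; and with this ring structure it is isomorphic, as a ring, to $$R_n=\mathbb Z[q]/(1+q+\dots+q^{n-1}).$$ -/

import Mathlib

open CategoryTheory TensorProduct Coalgebra

universe u

/-! ## Finite-dimensional modules over a finite-dimensional algebra or bialgebra -/

/-- A finite-dimensional left module over the `k`-algebra `H`, given as a finite-dimensional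
`k`-vector space together with an algebra homomorphism `ρ : H → End_k(V)`. -/
structure FDMod (k H : Type u) [Field k] [Ring H] [Algebra k H] where
  carrier : Type u
  [addCommGroup : AddCommGroup carrier]
  [module : Module k carrier]
  [finite : Module.Finite k carrier]
  ρ : H →ₐ[k] Module.End k carrier

namespace FDMod

attribute [instance] FDMod.addCommGroup FDMod.module FDMod.finite

section Algebra

variable {k H : Type u} [Field k] [Ring H] [Algebra k H]

/-- Homomorphisms of `H`-modules. -/
@[ext]
structure Hom (X Y : FDMod k H) where
  toLin : X.carrier →ₗ[k] Y.carrier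
  comm : ∀ (h : H) (x : X.carrier), toLin (X.ρ h x) = Y.ρ h (toLin x)

/-- The category `H`-mod of finite-dimensional left `H`-modules. -/
instance : Category.{u} (FDMod k H) where
  Hom X Y := Hom X Y
  id X := ⟨LinearMap.id, fun _ _ => rfl⟩
  comp f g := ⟨g.toLin ∘ₗ f.toLin, fun h x => by simp [f.comm, g.comm]⟩

/-- `P` is projective as a module over the ring `H`. -/
def IsProjective (P : FDMod k H) : Prop :=
  @Module.Projective H _ P.carrier _ (Module.compHom P.carrier P.ρ.toRingHom)

/-- The regular module `H`. -/
noncomputable def reg (k H : Type u) [Field k] [Ring H] [Algebra k H] [Module.Finite k H] :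
    FDMod k H where
  carrier := H
  ρ := Algebra.lmul k H

/-- The direct sum `X ⊕ Y`. -/
noncomputable def prod (X Y : FDMod k H) : FDMod k H where
  carrier := X.carrier × Y.carrier
  ρ := AlgHom.ofLinearMap
    { toFun := fun h => (X.ρ h).prodMap (Y.ρ h)
      map_add' := fun a b => by ext <;> simp
      map_smul' := fun c a => by ext <;> simp }
    (by ext <;> simp)
    (fun a b => by ext <;> simp)

/-- The cokernel `Y / f(X)` of a homomorphism of modules. -/
noncomputable def coker {X Y : FDMod k H} (f : X ⟶ Y) : FDMod k H where
  carrier := Y.carrier ⧸ LinearMap.range (Hom.toLin f)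
  ρ := AlgHom.ofLinearMap
    { toFun := fun h => (LinearMap.range (Hom.toLin f)).mapQ (LinearMap.range (Hom.toLin f))
        (Y.ρ h) (by rintro _ ⟨x, rfl⟩; exact ⟨X.ρ h x, Hom.comm f h x⟩)
      map_add' := fun a b => by ext; simp
      map_smul' := fun c a => by ext; simp }
    (by ext; simp)
    (fun a b => by ext; simp)

/-- The projection `Y → Y / f(X)`. -/
noncomputable def cokerMk {X Y : FDMod k H} (f : X ⟶ Y) : Y ⟶ coker f where
  toLin := (LinearMap.range (Hom.toLin f)).mkQ
  comm _ _ := rfl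

/-- A homomorphism out of `Y` that kills `f(X)` descends to `Y / f(X)`. -/
noncomputable def cokerDesc {X Y Z : FDMod k H} (f : X ⟶ Y) (g : Y ⟶ Z)
    (w : ∀ x : X.carrier, Hom.toLin g (Hom.toLin f x) = 0) : coker f ⟶ Z where
  toLin := (LinearMap.range (Hom.toLin f)).liftQ (Hom.toLin g)
    (by rintro _ ⟨x, rfl⟩; exact w x)
  comm h x := by
    obtain ⟨y, rfl⟩ := Submodule.Quotient.mk_surjective _ x
    exact Hom.comm g h y

/-- Two homomorphisms `f, g : X → Y` are identified in the stable category when their difference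
factors through a projective module. -/
def stableRel (k H : Type u) [Field k] [Ring H] [Algebra k H] : HomRel (FDMod k H) :=
  fun X Y f g => ∃ (P : FDMod k H) (a : X ⟶ P) (b : P ⟶ Y), P.IsProjective ∧
    Hom.toLin f - Hom.toLin g = Hom.toLin (a ≫ b)

end Algebra

section Bialgebra

variable {k H : Type u} [Field k] [Ring H] [Bialgebra k H]

/-- The unit object: the ground field, on which `H` acts through the counit. -/
noncomputable def unit (k H : Type u) [Field k] [Ring H] [Bialgebra k H] : FDMod k H where
  carrier := k
  ρ := (Algebra.lmul k k).comp (Bialgebra.counitAlgHom k H)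

/-- The action of `H ⊗ H` on the vector space `X ⊗ Y`. -/
noncomputable def tensorAct (X Y : FDMod k H) :
    H ⊗[k] H →ₐ[k] Module.End k (X.carrier ⊗[k] Y.carrier) :=
  (Module.endTensorEndAlgHom (R := k) (S := k) (A := k)).comp
    (Algebra.TensorProduct.map X.ρ Y.ρ)

@[simp]
theorem tensorAct_tmul (X Y : FDMod k H) (a b : H) (x : X.carrier) (y : Y.carrier) :
    tensorAct X Y (a ⊗ₜ b) (x ⊗ₜ y) = X.ρ a x ⊗ₜ Y.ρ b y := rfl

/-- The tensor product over `k`, on which `H` acts through the comultiplication. -/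
noncomputable def tensor (X Y : FDMod k H) : FDMod k H where
  carrier := X.carrier ⊗[k] Y.carrier
  ρ := (tensorAct X Y).comp (Bialgebra.comulAlgHom k H)

theorem tensorAct_map {X X' Y Y' : FDMod k H} (f : X ⟶ X') (g : Y ⟶ Y') (t : H ⊗[k] H)
    (z : X.carrier ⊗[k] Y.carrier) :
    TensorProduct.map (Hom.toLin f) (Hom.toLin g) (tensorAct X Y t z) =
      tensorAct X' Y' t (TensorProduct.map (Hom.toLin f) (Hom.toLin g) z) := by
  induction t using TensorProduct.induction_on with
  | zero => simp
  | add a b ha hb => simp only [map_add, LinearMap.add_apply, ha, hb]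
  | tmul a b =>
    induction z using TensorProduct.induction_on with
    | zero => simp
    | add x y hx hy => simp only [map_add, hx, hy]
    | tmul x y => simp [Hom.comm]

/-- The tensor product of homomorphisms. -/
noncomputable def tensorHom {X X' Y Y' : FDMod k H} (f : X ⟶ X') (g : Y ⟶ Y') :
    tensor X Y ⟶ tensor X' Y' where
  toLin := TensorProduct.map (Hom.toLin f) (Hom.toLin g)
  comm h z := tensorAct_map f g (comul (R := k) h) z

end Bialgebra

end FDMod

/-! ## The stable category of a finite-dimensional Hopf algebra and its Grothendieck group -/

/-- A left integral of the Hopf algebra `H`: a nonzero `Λ` with `hΛ = ε(h)Λ` for all `h`. -/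
structure LeftIntegral (k H : Type u) [Field k] [Ring H] [HopfAlgebra k H] where
  elem : H
  ne_zero : elem ≠ 0
  mul_elem : ∀ h : H, h * elem = counit (R := k) h • elem

/-- The stable category: finite-dimensional `H`-modules, with homomorphisms taken modulo those
that factor through a projective (equivalently, injective) module. -/
abbrev StMod (k H : Type u) [Field k] [Ring H] [HopfAlgebra k H] :=
  CategoryTheory.Quotient (FDMod.stableRel k H)

namespace StMod

open FDMod

section

variable {k H : Type u} [Field k] [Ring H] [HopfAlgebra k H]

/-- A module, viewed as an object of the stable category. -/
abbrev of (X : FDMod k H) : StMod k H := ⟨X⟩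

/-- The class in the stable category of a homomorphism of modules. -/
abbrev res {X Y : FDMod k H} (f : X ⟶ Y) : of X ⟶ of Y :=
  (CategoryTheory.Quotient.functor (stableRel k H)).map f

end

variable {k H : Type u} [Field k] [Ring H] [HopfAlgebra k H] [Module.Finite k H]
variable (Λ : LeftIntegral k H)

/-- The integral `Λ`, viewed as an element of the regular module. -/
def vec : (reg k H).carrier := Λ.elem

theorem act_vec (h : H) : (reg k H).ρ h (vec Λ) = counit (R := k) h • vec Λ := Λ.mul_elem h

/-- The embedding `k → H`, `c ↦ cΛ`, of the trivial module. -/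
noncomputable def integralHom : unit k H ⟶ reg k H where
  toLin := LinearMap.toSpanSingleton k (reg k H).carrier (vec Λ)
  comm h (c : k) := by
    change (counit (R := k) h * c) • vec Λ = (reg k H).ρ h (c • vec Λ)
    rw [map_smul, act_vec, smul_smul, mul_comm]

theorem tensorAct_integral (X : FDMod k H) (t : H ⊗[k] H) (x : X.carrier) :
    tensorAct (reg k H) X t (vec Λ ⊗ₜ[k] x) =
      vec Λ ⊗ₜ[k] X.ρ (TensorProduct.lid k H ((counit (R := k)).rTensor H t)) x := by
  induction t using TensorProduct.induction_on with
  | zero => simp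
  | add a b ha hb => simp only [map_add, LinearMap.add_apply, ha, hb, TensorProduct.tmul_add]
  | tmul a b =>
    simp [act_vec, TensorProduct.smul_tmul]

/-- The embedding `X → H ⊗ X`, `x ↦ Λ ⊗ x`. -/
noncomputable def embed (X : FDMod k H) : X ⟶ tensor (reg k H) X where
  toLin := TensorProduct.mk k (reg k H).carrier X.carrier (vec Λ)
  comm h x := by
    have := tensorAct_integral Λ X (comul (R := k) h) x
    rw [Coalgebra.rTensor_counit_comul, TensorProduct.lid_tmul, one_smul] at this
    exact this.symm

/-- The shift `T X = (H / kΛ) ⊗ X`. -/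
noncomputable def shift (X : FDMod k H) : FDMod k H := tensor (coker (integralHom Λ)) X

/-- The shift of a homomorphism of modules. -/
noncomputable def shiftMap {X Y : FDMod k H} (f : X ⟶ Y) : shift Λ X ⟶ shift Λ Y :=
  tensorHom (𝟙 _) f

/-- The homomorphism `X → Y ⊕ (H ⊗ X)`, `x ↦ (u x, - Λ ⊗ x)`, whose cokernel is the pushout
of `u : X → Y` and `X → H ⊗ X`. -/
noncomputable def pushoutHom {X Y : FDMod k H} (u : X ⟶ Y) :
    X ⟶ FDMod.prod Y (tensor (reg k H) X) where
  toLin := (Hom.toLin u).prod (-(Hom.toLin (embed Λ X)))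
  comm h x := Prod.ext (Hom.comm u h x)
    ((congrArg Neg.neg (Hom.comm (embed Λ X) h x)).trans (map_neg _ _).symm)

/-- The cone of `u : X → Y`: the pushout of `u` and the embedding `X → H ⊗ X`. -/
noncomputable def cone {X Y : FDMod k H} (u : X ⟶ Y) : FDMod k H := coker (pushoutHom Λ u)

/-- The homomorphism `v : Y → C_u`. -/
noncomputable def coneIn {X Y : FDMod k H} (u : X ⟶ Y) : Y ⟶ cone Λ u where
  toLin := Hom.toLin (cokerMk (pushoutHom Λ u)) ∘ₗ
    LinearMap.inl k Y.carrier (tensor (reg k H) X).carrier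
  comm h y := by
    refine Eq.trans (congrArg (Hom.toLin (cokerMk (pushoutHom Λ u))) ?_)
      (Hom.comm (cokerMk (pushoutHom Λ u)) h (y, 0))
    exact Prod.ext rfl (map_zero ((tensor (reg k H) X).ρ h)).symm

/-- The homomorphism `Y ⊕ (H ⊗ X) → T X`, `(y, h ⊗ x) ↦ [h] ⊗ x`. -/
noncomputable def prodToShift (X Y : FDMod k H) :
    FDMod.prod Y (tensor (reg k H) X) ⟶ shift Λ X where
  toLin := Hom.toLin (tensorHom (cokerMk (integralHom Λ)) (𝟙 X)) ∘ₗ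
    LinearMap.snd k Y.carrier (tensor (reg k H) X).carrier
  comm h z := Hom.comm (tensorHom (cokerMk (integralHom Λ)) (𝟙 X)) h z.2

/-- The homomorphism `w : C_u → T X`. -/
noncomputable def coneOut {X Y : FDMod k H} (u : X ⟶ Y) : cone Λ u ⟶ shift Λ X :=
  cokerDesc (pushoutHom Λ u) (prodToShift Λ X Y) (by
    intro x
    change TensorProduct.map _ _ (-(vec Λ ⊗ₜ[k] x)) = _
    rw [map_neg, TensorProduct.map_tmul]
    have : Hom.toLin (cokerMk (integralHom Λ)) (vec Λ) = 0 :=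
      (Submodule.Quotient.mk_eq_zero _).2 ⟨(1 : k), one_smul k (vec Λ)⟩
    rw [this, TensorProduct.zero_tmul, neg_zero]
    rfl)

/-- Distinguished triangles `X → Y → Z → T X` in the stable category: those isomorphic in the
stable category to the standard triangle `X' → Y' → C_u → T X'` of a homomorphism `u` of modules.
The shift of a morphism `a` of the stable category is the class of `shiftMap` of a homomorphism
representing it; so the first component of the isomorphism is given by a representative. -/
def IsDistinguished {X Y Z : StMod k H} (f : X ⟶ Y) (g : Y ⟶ Z) (h : Z ⟶ of (shift Λ X.as)) :
    Prop :=
  ∃ (X' Y' : FDMod k H) (u : X' ⟶ Y') (a : X.as ⟶ X') (b : Y ≅ of Y') (c : Z ≅ of (cone Λ u)),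
    IsIso (res a) ∧
    f ≫ b.hom = (res a : X ⟶ of X') ≫ res u ∧
    g ≫ c.hom = b.hom ≫ res (coneIn Λ u) ∧
    h ≫ res (shiftMap Λ a) = c.hom ≫ res (coneOut Λ u)

/-- The Grothendieck group of the stable category: generators `[X]` for all objects `X`, relations
`[Y] = [X] + [Z]` for all distinguished triangles `X → Y → Z → T X`. -/
def GrothendieckGroup : Type (u + 1) :=
  FreeAbelianGroup (StMod k H) ⧸ AddSubgroup.closure
    {r : FreeAbelianGroup (StMod k H) |
      ∃ (X Y Z : StMod k H) (f : X ⟶ Y) (g : Y ⟶ Z) (h : Z ⟶ of (shift Λ X.as)),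
        IsDistinguished Λ f g h ∧
        r = FreeAbelianGroup.of Y - (FreeAbelianGroup.of X + FreeAbelianGroup.of Z)}

noncomputable instance groupStructure : AddCommGroup (GrothendieckGroup Λ) :=
  inferInstanceAs (AddCommGroup (FreeAbelianGroup (StMod k H) ⧸ AddSubgroup.closure _))

/-- The class `[X]` in the Grothendieck group. -/
def cls (X : StMod k H) : GrothendieckGroup Λ :=
  QuotientAddGroup.mk (FreeAbelianGroup.of X)

/-- The ring structure `r` on the set underlying the Grothendieck group is that of the
Grothendieck ring: it has the given addition, `1 = [𝟏]` is the class of the unit object, and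
`[X][Y] = [X ⊗ Y]`. -/
structure IsGrothendieckRing (r : Ring (GrothendieckGroup Λ)) : Prop where
  add_eq : ∀ x y : GrothendieckGroup Λ, r.add x y = (groupStructure Λ).add x y
  one_eq : r.one = cls Λ (of (unit k H))
  mul_eq : ∀ X Y : FDMod k H,
    r.mul (cls Λ (of X)) (cls Λ (of Y)) = cls Λ (of (tensor X Y))

end StMod

/-! ## The Taft Hopf algebra -/

namespace Taft

/-- The generators `K`, `X`. -/
inductive Gen
  | K
  | X

/-- The relations `KX = ζXK`, `K^n = 1`, `X^n = 0`. -/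
inductive Rel {k : Type u} [Field k] (n : ℕ) (ζ : k) :
    FreeAlgebra k Gen → FreeAlgebra k Gen → Prop
  | comm : Rel n ζ (FreeAlgebra.ι k Gen.K * FreeAlgebra.ι k Gen.X)
      (ζ • (FreeAlgebra.ι k Gen.X * FreeAlgebra.ι k Gen.K))
  | pow_K : Rel n ζ (FreeAlgebra.ι k Gen.K ^ n) 1
  | pow_X : Rel n ζ (FreeAlgebra.ι k Gen.X ^ n) 0

end Taft

/-- The Taft algebra `H_n`: the `k`-algebra with generators `K`, `X` and relations `KX = ζXK`,
`K^n = 1`, `X^n = 0`, where `ζ` is a primitive `n`-th root of unity and `n > 1`. -/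
def TaftAlgebra {k : Type u} [Field k] {n : ℕ} {ζ : k} (_hn : 1 < n)
    (_hζ : IsPrimitiveRoot ζ n) : Type u :=
  RingQuot (Taft.Rel n ζ)

namespace Taft

section qBinomial

variable {k : Type u} [Field k]

/-- The `q`-binomial coefficients, by their Pascal rule. -/
def qBinom (q : k) : ℕ → ℕ → k
  | 0, 0 => 1
  | 0, _ + 1 => 0
  | _ + 1, 0 => 1
  | m + 1, j + 1 => qBinom q m j + q ^ (j + 1) * qBinom q m (j + 1)

theorem qBinom_zero_right (q : k) (m : ℕ) : qBinom q m 0 = 1 := by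
  cases m <;> rfl

theorem qBinom_eq_zero (q : k) (m : ℕ) : ∀ j, m < j → qBinom q m j = 0 := by
  induction m with
  | zero => rintro (_ | j) h; · omega
            rfl
  | succ m ih =>
    rintro (_ | j) h
    · omega
    · rw [qBinom, ih j (by omega), ih (j + 1) (by omega)]; simp

theorem qBinom_self (q : k) (m : ℕ) : qBinom q m m = 1 := by
  induction m with
  | zero => rfl
  | succ m ih => rw [qBinom, ih, qBinom_eq_zero q m (m + 1) (by omega)]; simp

/-- The `q`-integer `1 + q + ⋯ + q^(m-1)`. -/
def qInt (q : k) (m : ℕ) : k := ∑ i ∈ Finset.range m, q ^ i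

/-- The `q`-factorial. -/
def qFact (q : k) (m : ℕ) : k := ∏ i ∈ Finset.range m, qInt q (i + 1)

theorem qInt_add (q : k) (a b : ℕ) : qInt q (a + b) = qInt q a + q ^ a * qInt q b := by
  simp only [qInt, Finset.sum_range_add, pow_add, Finset.mul_sum]

theorem qFact_succ (q : k) (m : ℕ) : qFact q (m + 1) = qInt q (m + 1) * qFact q m := by
  rw [qFact, Finset.prod_range_succ, mul_comm]; rfl

theorem qBinom_mul_qFact (q : k) (m : ℕ) : ∀ i j, i + j = m →
    qBinom q m i * (qFact q i * qFact q j) = qFact q m := by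
  induction m with
  | zero =>
    intro i j h
    obtain ⟨rfl, rfl⟩ : i = 0 ∧ j = 0 := by omega
    simp [qBinom, qFact]
  | succ m ih =>
    rintro (_ | i) j h
    · obtain rfl : j = m + 1 := by omega
      simp [qBinom, qFact]
    · rcases j with _ | j
      · obtain rfl : i = m := by omega
        rw [qBinom_self]; simp [qFact]
      · have h1 := ih i (j + 1) (by omega)
        have h2 := ih (i + 1) j (by omega)
        have h3 : qInt q (m + 1) = qInt q (i + 1) + q ^ (i + 1) * qInt q (j + 1) := by
          rw [← qInt_add]; congr 1; omega
        rw [qFact_succ q m, qBinom, h3]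
        rw [qFact_succ q j] at h1 ⊢
        rw [qFact_succ q i] at h2 ⊢
        linear_combination (qInt q (i + 1)) * h1 + (q ^ (i + 1) * qInt q (j + 1)) * h2

theorem qInt_ne_zero {n : ℕ} {ζ : k} (hζ : IsPrimitiveRoot ζ n) {m : ℕ} (h0 : 0 < m)
    (hm : m < n) : qInt ζ m ≠ 0 := by
  intro h
  have h1 : qInt ζ m * (ζ - 1) = ζ ^ m - 1 := geom_sum_mul ζ m
  rw [h, zero_mul, eq_comm, sub_eq_zero] at h1
  exact hζ.pow_ne_one_of_pos_of_lt h0.ne' hm h1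

theorem qBinom_root {n : ℕ} {ζ : k} (hn : 1 < n) (hζ : IsPrimitiveRoot ζ n) {j : ℕ}
    (h0 : 0 < j) (hj : j < n) : qBinom ζ n j = 0 := by
  have h := qBinom_mul_qFact ζ n j (n - j) (by omega)
  have hz : qFact ζ n = 0 :=
    Finset.prod_eq_zero (Finset.mem_range.2 (show n - 1 < n by omega))
      (by rw [Nat.sub_add_cancel hn.le]; exact hζ.geom_sum_eq_zero hn)
  have hne : ∀ m, m < n → qFact ζ m ≠ 0 := fun m hm =>
    Finset.prod_ne_zero_iff.2 fun i hi =>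
      qInt_ne_zero hζ (by omega) (by have := Finset.mem_range.1 hi; omega)
  rw [hz] at h
  exact (mul_eq_zero.1 h).resolve_right (mul_ne_zero (hne j hj) (hne _ (by omega)))

/-- The `q`-binomial formula for `ba = q ab`. -/
theorem add_pow_q {A : Type*} [Ring A] [Algebra k A] (q : k) (a b : A)
    (h : b * a = q • (a * b)) (m : ℕ) :
    (a + b) ^ m = ∑ j ∈ Finset.range (m + 1), qBinom q m j • (a ^ j * b ^ (m - j)) := by
  have hb : ∀ j, b * a ^ j = q ^ j • (a ^ j * b) := by
    intro j
    induction j with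
    | zero => simp
    | succ j ih =>
      rw [pow_succ, ← mul_assoc, ih, smul_mul_assoc, mul_assoc, h, mul_smul_comm, smul_smul,
        ← pow_succ, mul_assoc]
  induction m with
  | zero => simp [qBinom]
  | succ m ih =>
    rw [pow_succ', ih, add_mul, Finset.mul_sum, Finset.mul_sum, Finset.sum_range_succ' _ (m + 1)]
    have e1 : ∑ j ∈ Finset.range (m + 1), a * qBinom q m j • (a ^ j * b ^ (m - j)) =
        ∑ j ∈ Finset.range (m + 1), qBinom q m j • (a ^ (j + 1) * b ^ (m - j)) :=
      Finset.sum_congr rfl fun j _ => by rw [mul_smul_comm, ← mul_assoc, ← pow_succ']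
    have e2 : ∑ j ∈ Finset.range (m + 1), b * qBinom q m j • (a ^ j * b ^ (m - j)) =
        ∑ j ∈ Finset.range (m + 1),
          (q ^ j * qBinom q m j) • (a ^ j * b ^ (m + 1 - j)) :=
      Finset.sum_congr rfl fun j hj => by
        have : j ≤ m := by have := Finset.mem_range.1 hj; omega
        rw [mul_smul_comm, ← mul_assoc, hb, smul_mul_assoc, smul_smul, mul_assoc, ← pow_succ',
          mul_comm, Nat.sub_add_comm this]
    have e3 : ∑ j ∈ Finset.range (m + 1),
          (q ^ j * qBinom q m j) • (a ^ j * b ^ (m + 1 - j)) =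
        ∑ j ∈ Finset.range (m + 1),
          (q ^ (j + 1) * qBinom q m (j + 1)) • (a ^ (j + 1) * b ^ (m - j)) + b ^ (m + 1) := by
      rw [Finset.sum_range_succ', Finset.sum_range_succ _ m, qBinom_eq_zero q m (m + 1) (by omega)]
      simp [qBinom_zero_right]
    rw [e1, e2, e3, ← add_assoc, ← Finset.sum_add_distrib]
    congr 1
    · refine Finset.sum_congr rfl fun j _ => ?_
      rw [qBinom, add_smul, Nat.add_sub_add_right]
    · simp [qBinom]

theorem add_pow_root {A : Type*} [Ring A] [Algebra k A] {n : ℕ} {ζ : k} (hn : 1 < n)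
    (hζ : IsPrimitiveRoot ζ n) (a b : A) (h : b * a = ζ • (a * b)) :
    (a + b) ^ n = a ^ n + b ^ n := by
  obtain ⟨m, rfl⟩ : ∃ m, n = m + 1 := ⟨n - 1, by omega⟩
  rw [add_pow_q ζ a b h, Finset.sum_range_succ, Finset.sum_range_succ',
    Finset.sum_eq_zero, qBinom_self, qBinom_zero_right]
  · simp [add_comm]
  · intro j hj
    rw [qBinom_root hn hζ (by omega) (by have := Finset.mem_range.1 hj; omega), zero_smul]

end qBinomial

section

variable {k : Type u} [Field k] {n : ℕ} {ζ : k} (hn : 1 < n) (hζ : IsPrimitiveRoot ζ n)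

noncomputable instance : Ring (TaftAlgebra hn hζ) := inferInstanceAs (Ring (RingQuot (Rel n ζ)))

noncomputable instance : Algebra k (TaftAlgebra hn hζ) :=
  inferInstanceAs (Algebra k (RingQuot (Rel n ζ)))

/-- The generator `K` of the Taft algebra. -/
noncomputable def K : TaftAlgebra hn hζ := RingQuot.mkAlgHom k (Rel n ζ) (FreeAlgebra.ι k Gen.K)

/-- The generator `X` of the Taft algebra. -/
noncomputable def X : TaftAlgebra hn hζ := RingQuot.mkAlgHom k (Rel n ζ) (FreeAlgebra.ι k Gen.X)

theorem K_mul_X : K hn hζ * X hn hζ = ζ • (X hn hζ * K hn hζ) := by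
  have := RingQuot.mkAlgHom_rel k (Rel.comm (n := n) (ζ := ζ))
  rw [map_mul, map_smul, map_mul] at this
  exact this

theorem K_pow : K hn hζ ^ n = 1 := by
  have := RingQuot.mkAlgHom_rel k (Rel.pow_K (n := n) (ζ := ζ))
  rw [map_pow, map_one] at this
  exact this

theorem X_pow : X hn hζ ^ n = 0 := by
  have := RingQuot.mkAlgHom_rel k (Rel.pow_X (n := n) (ζ := ζ))
  rw [map_pow, map_zero] at this
  exact this

/-- The algebra homomorphism from the Taft algebra given by the images `a`, `b` of `K`, `X`. -/
noncomputable def lift {A : Type*} [Ring A] [Algebra k A] (a b : A) (h1 : a * b = ζ • (b * a))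
    (h2 : a ^ n = 1) (h3 : b ^ n = 0) : TaftAlgebra hn hζ →ₐ[k] A :=
  RingQuot.liftAlgHom k ⟨FreeAlgebra.lift k (fun g => match g with | Gen.K => a | Gen.X => b), by
    rintro _ _ (_ | _ | _)
    · simpa using h1
    · simpa using h2
    · simpa using h3⟩

section

variable {A : Type*} [Ring A] [Algebra k A] (a b : A) (h1 : a * b = ζ • (b * a))
    (h2 : a ^ n = 1) (h3 : b ^ n = 0)

@[simp]
theorem lift_K : lift hn hζ a b h1 h2 h3 (K hn hζ) = a := by
  refine (RingQuot.liftAlgHom_mkAlgHom_apply _ _ _ _).trans ?_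
  simp

@[simp]
theorem lift_X : lift hn hζ a b h1 h2 h3 (X hn hζ) = b := by
  refine (RingQuot.liftAlgHom_mkAlgHom_apply _ _ _ _).trans ?_
  simp

end

theorem algHom_ext {hn : 1 < n} {hζ : IsPrimitiveRoot ζ n} {A : Type*} [Ring A] [Algebra k A]
    {f g : TaftAlgebra hn hζ →ₐ[k] A} (hK : f (K hn hζ) = g (K hn hζ))
    (hX : f (X hn hζ) = g (X hn hζ)) : f = g := by
  refine RingQuot.ringQuot_ext' (S := k) (s := Rel n ζ) f g ?_
  refine FreeAlgebra.hom_ext (funext fun x => ?_)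
  cases x
  · exact hK
  · exact hX

/-- The algebra is generated by `K` and `X`. -/
theorem mem_of_subalgebra (S : Subalgebra k (TaftAlgebra hn hζ)) (hK : K hn hζ ∈ S)
    (hX : X hn hζ ∈ S) (x : TaftAlgebra hn hζ) : x ∈ S := by
  let f : TaftAlgebra hn hζ →ₐ[k] S := lift hn hζ ⟨_, hK⟩ ⟨_, hX⟩
    (Subtype.ext (K_mul_X hn hζ)) (Subtype.ext (K_pow hn hζ)) (Subtype.ext (X_pow hn hζ))
  have : S.val.comp f = AlgHom.id k _ := algHom_ext (by simp [f]) (by simp [f])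
  rw [← AlgHom.id_apply (R := k) x, ← this]
  exact (f x).2

/-- The comultiplication `Δ(K) = K ⊗ K`, `Δ(X) = X ⊗ 1 + K ⊗ X`. -/
noncomputable def comulHom :
    TaftAlgebra hn hζ →ₐ[k] TaftAlgebra hn hζ ⊗[k] TaftAlgebra hn hζ :=
  lift hn hζ (K hn hζ ⊗ₜ K hn hζ) (X hn hζ ⊗ₜ 1 + K hn hζ ⊗ₜ X hn hζ)
    (by
      rw [mul_add, add_mul, smul_add]
      simp only [Algebra.TensorProduct.tmul_mul_tmul, mul_one, one_mul, K_mul_X,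
        TensorProduct.smul_tmul', TensorProduct.tmul_smul])
    (by simp only [Algebra.TensorProduct.tmul_pow, K_pow, Algebra.TensorProduct.one_def])
    (by
      rw [add_pow_root hn hζ]
      · simp only [Algebra.TensorProduct.tmul_pow, X_pow, TensorProduct.zero_tmul,
          TensorProduct.tmul_zero, add_zero]
      · simp only [Algebra.TensorProduct.tmul_mul_tmul, mul_one, one_mul, K_mul_X,
          TensorProduct.smul_tmul'])

/-- The counit `ε(K) = 1`, `ε(X) = 0`. -/
noncomputable def counitHom : TaftAlgebra hn hζ →ₐ[k] k :=
  lift hn hζ 1 0 (by simp) (by simp) (zero_pow (by omega))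

noncomputable instance : Bialgebra k (TaftAlgebra hn hζ) :=
  Bialgebra.ofAlgHom (comulHom hn hζ) (counitHom hn hζ)
    (algHom_ext (by simp [comulHom])
      (by simp [comulHom, TensorProduct.tmul_add, TensorProduct.add_tmul,
        Algebra.TensorProduct.one_def, add_assoc]))
    (algHom_ext (by simp [comulHom, counitHom]) (by simp [comulHom, counitHom]))
    (algHom_ext (by simp [comulHom, counitHom]) (by simp [comulHom, counitHom]))

theorem comul_K : comul (R := k) (K hn hζ) = K hn hζ ⊗ₜ K hn hζ := lift_K ..

theorem comul_X : comul (R := k) (X hn hζ) = X hn hζ ⊗ₜ 1 + K hn hζ ⊗ₜ X hn hζ := lift_X ..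

theorem counit_K : counit (R := k) (K hn hζ) = 1 := lift_K ..

theorem counit_X : counit (R := k) (X hn hζ) = 0 := lift_X ..

theorem K_mul_K_pow : K hn hζ * K hn hζ ^ (n - 1) = 1 := by
  rw [← pow_succ', Nat.sub_add_cancel hn.le, K_pow]

theorem K_pow_mul_K : K hn hζ ^ (n - 1) * K hn hζ = 1 := by
  rw [← pow_succ, Nat.sub_add_cancel hn.le, K_pow]

theorem K_pow_mul_X (m : ℕ) :
    K hn hζ ^ m * X hn hζ = ζ ^ m • (X hn hζ * K hn hζ ^ m) := by
  induction m with
  | zero => simp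
  | succ m ih =>
    rw [pow_succ, mul_assoc, K_mul_X, mul_smul_comm, ← mul_assoc, ih, smul_mul_assoc, smul_smul,
      mul_assoc, ← pow_succ, ← pow_succ']

theorem exists_mul_pow {A : Type*} [Ring A] [Algebra k A] (a b : A) (c : k)
    (h : b * a = c • (a * b)) (m : ℕ) : ∃ d : k, (a * b) ^ m = d • (a ^ m * b ^ m) := by
  have hb : ∀ j, b * a ^ j = c ^ j • (a ^ j * b) := by
    intro j
    induction j with
    | zero => simp
    | succ j ih =>
      rw [pow_succ, ← mul_assoc, ih, smul_mul_assoc, mul_assoc, h, mul_smul_comm, smul_smul,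
        ← pow_succ, mul_assoc]
  induction m with
  | zero => exact ⟨1, by simp⟩
  | succ m ih =>
    obtain ⟨d, hd⟩ := ih
    refine ⟨d * c ^ m, ?_⟩
    rw [pow_succ', hd, mul_smul_comm, mul_assoc, ← mul_assoc b, hb, smul_mul_assoc, mul_smul_comm,
      smul_smul, mul_assoc, ← pow_succ', ← mul_assoc, ← pow_succ']

theorem X_mul_K_pow : X hn hζ * K hn hζ ^ (n - 1) = ζ • (K hn hζ ^ (n - 1) * X hn hζ) := by
  rw [K_pow_mul_X, smul_smul, ← pow_succ', Nat.sub_add_cancel hn.le, hζ.pow_eq_one, one_smul]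

/-- The antipode `S(K) = K⁻¹`, `S(X) = -K⁻¹X`, as a homomorphism to the opposite algebra
(where `K⁻¹ = K^(n-1)`). -/
noncomputable def antipodeHom : TaftAlgebra hn hζ →ₐ[k] (TaftAlgebra hn hζ)ᵐᵒᵖ :=
  lift hn hζ (MulOpposite.op (K hn hζ ^ (n - 1))) (MulOpposite.op (-(K hn hζ ^ (n - 1) * X hn hζ)))
    (by
      rw [← MulOpposite.op_mul, ← MulOpposite.op_mul, ← MulOpposite.op_smul]
      congr 1
      rw [neg_mul, mul_neg, smul_neg, mul_assoc, X_mul_K_pow, mul_smul_comm])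
    (by rw [← MulOpposite.op_pow, ← pow_mul, mul_comm, pow_mul, K_pow, one_pow]; rfl)
    (by
      obtain ⟨d, hd⟩ := exists_mul_pow _ _ ζ (X_mul_K_pow hn hζ) n
      rw [← MulOpposite.op_pow, neg_pow, hd, X_pow, mul_zero, smul_zero, mul_zero]; rfl)

/-- The antipode as a linear map. -/
noncomputable def antipodeLin : TaftAlgebra hn hζ →ₗ[k] TaftAlgebra hn hζ :=
  (MulOpposite.opLinearEquiv k).symm.toLinearMap ∘ₗ (antipodeHom hn hζ).toLinearMap

theorem antipodeLin_one : antipodeLin hn hζ 1 = 1 := by simp [antipodeLin]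

theorem antipodeLin_mul (a b : TaftAlgebra hn hζ) :
    antipodeLin hn hζ (a * b) = antipodeLin hn hζ b * antipodeLin hn hζ a := by
  simp [antipodeLin]

theorem antipodeLin_K : antipodeLin hn hζ (K hn hζ) = K hn hζ ^ (n - 1) := by
  simp [antipodeLin, antipodeHom]

theorem antipodeLin_X : antipodeLin hn hζ (X hn hζ) = -(K hn hζ ^ (n - 1) * X hn hζ) := by
  simp [antipodeLin, antipodeHom]

theorem mul_rTensor (s : (TaftAlgebra hn hζ) ⊗[k] TaftAlgebra hn hζ) (a b : TaftAlgebra hn hζ) :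
    LinearMap.mul' k _ (LinearMap.rTensor _ (antipodeLin hn hζ) (s * a ⊗ₜ b)) =
      (antipodeLin hn hζ) a * LinearMap.mul' k _ (LinearMap.rTensor _ (antipodeLin hn hζ) s) * b := by
  induction s using TensorProduct.induction_on with
  | zero => simp
  | add x y hx hy => simp only [add_mul, mul_add, map_add, hx, hy]
  | tmul x y => simp [antipodeLin_mul, mul_assoc]

theorem mul_lTensor (t : (TaftAlgebra hn hζ) ⊗[k] TaftAlgebra hn hζ) (a b : TaftAlgebra hn hζ) :
    LinearMap.mul' k _ (LinearMap.lTensor _ (antipodeLin hn hζ) (a ⊗ₜ b * t)) =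
      a * LinearMap.mul' k _ (LinearMap.lTensor _ (antipodeLin hn hζ) t) * (antipodeLin hn hζ) b := by
  induction t using TensorProduct.induction_on with
  | zero => simp
  | add x y hx hy => simp only [add_mul, mul_add, map_add, hx, hy]
  | tmul x y => simp [antipodeLin_mul, mul_assoc]

/-- The elements at which the first antipode axiom holds. -/
noncomputable def leftSubalgebra : Subalgebra k (TaftAlgebra hn hζ) where
  carrier := {h | LinearMap.mul' k _ (LinearMap.rTensor _ (antipodeLin hn hζ) (comul (R := k) h)) =
    algebraMap k (TaftAlgebra hn hζ) (counit (R := k) h)}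
  mul_mem' {g h} hg hh := by
    have key : ∀ t : (TaftAlgebra hn hζ) ⊗[k] (TaftAlgebra hn hζ),
        LinearMap.mul' k _ (LinearMap.rTensor _ (antipodeLin hn hζ) (comul (R := k) g * t)) =
          counit (R := k) g • LinearMap.mul' k _ (LinearMap.rTensor _ (antipodeLin hn hζ) t) := by
      intro t
      induction t using TensorProduct.induction_on with
      | zero => simp
      | add x y hx hy => simp only [mul_add, map_add, hx, hy, smul_add]
      | tmul x y =>
        rw [mul_rTensor, hg, ← Algebra.commutes, ← Algebra.smul_def]
        simp
    change _ = _
    rw [Bialgebra.comul_mul, key, hh, Bialgebra.counit_mul, map_mul, Algebra.smul_def]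
  add_mem' {g h} hg hh := by
    change _ = _
    rw [map_add, map_add, map_add, hg, hh, map_add, map_add]
  algebraMap_mem' c := by
    change _ = _
    rw [Bialgebra.comul_algebraMap, Bialgebra.counit_algebraMap,
      Algebra.TensorProduct.algebraMap_apply]
    simp [Algebra.algebraMap_eq_smul_one, antipodeLin_one]

/-- The elements at which the second antipode axiom holds. -/
noncomputable def rightSubalgebra : Subalgebra k (TaftAlgebra hn hζ) where
  carrier := {h | LinearMap.mul' k _ (LinearMap.lTensor _ (antipodeLin hn hζ) (comul (R := k) h)) =
    algebraMap k (TaftAlgebra hn hζ) (counit (R := k) h)}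
  mul_mem' {g h} hg hh := by
    have key : ∀ t : (TaftAlgebra hn hζ) ⊗[k] (TaftAlgebra hn hζ),
        LinearMap.mul' k _ (LinearMap.lTensor _ (antipodeLin hn hζ) (t * comul (R := k) h)) =
          counit (R := k) h • LinearMap.mul' k _ (LinearMap.lTensor _ (antipodeLin hn hζ) t) := by
      intro t
      induction t using TensorProduct.induction_on with
      | zero => simp
      | add x y hx hy => simp only [add_mul, map_add, hx, hy, smul_add]
      | tmul x y =>
        rw [mul_lTensor, hh, ← Algebra.commutes, mul_assoc, ← Algebra.smul_def]
        simp
    change _ = _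
    rw [Bialgebra.comul_mul, key, hg, Bialgebra.counit_mul, map_mul, ← Algebra.commutes,
      Algebra.smul_def]
  add_mem' {g h} hg hh := by
    change _ = _
    rw [map_add, map_add, map_add, hg, hh, map_add, map_add]
  algebraMap_mem' c := by
    change _ = _
    rw [Bialgebra.comul_algebraMap, Bialgebra.counit_algebraMap,
      Algebra.TensorProduct.algebraMap_apply]
    simp [Algebra.algebraMap_eq_smul_one, antipodeLin_one]

/-- The Taft Hopf algebra. -/
noncomputable instance : HopfAlgebra k (TaftAlgebra hn hζ) where
  antipode := antipodeLin hn hζ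
  mul_antipode_rTensor_comul := LinearMap.ext <| mem_of_subalgebra hn hζ (leftSubalgebra hn hζ)
    (by
      change _ = _
      rw [comul_K, counit_K]
      simp [antipodeLin_K, K_pow_mul_K])
    (by
      change _ = _
      rw [comul_X, counit_X]
      simp [antipodeLin_K, antipodeLin_X])
  mul_antipode_lTensor_comul := LinearMap.ext <| mem_of_subalgebra hn hζ (rightSubalgebra hn hζ)
    (by
      change _ = _
      rw [comul_K, counit_K]
      simp [antipodeLin_K, K_mul_K_pow])
    (by
      change _ = _
      rw [comul_X, counit_X]
      simp [antipodeLin_X, antipodeLin_one, ← mul_assoc, K_mul_K_pow])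

/-- The span of the monomials `K^i X^j`. -/
noncomputable def monomialSpan : Submodule k (TaftAlgebra hn hζ) :=
  Submodule.span k (Set.range fun p : Fin n × Fin n => K hn hζ ^ (p.1 : ℕ) * X hn hζ ^ (p.2 : ℕ))

theorem monomial_mem (i j : ℕ) : K hn hζ ^ i * X hn hζ ^ j ∈ monomialSpan hn hζ := by
  have h0 : 0 < n := by omega
  by_cases hj : j < n
  · rw [← Nat.div_add_mod i n, pow_add, pow_mul, K_pow, one_pow, one_mul]
    exact Submodule.subset_span ⟨(⟨i % n, Nat.mod_lt _ h0⟩, ⟨j, hj⟩), rfl⟩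
  · rw [← Nat.add_sub_of_le (not_lt.1 hj), pow_add, X_pow, zero_mul, mul_zero]
    exact Submodule.zero_mem _

/-- The elements that multiply the span of the monomials into itself. -/
noncomputable def stabilizer : Subalgebra k (TaftAlgebra hn hζ) where
  carrier := {a | ∀ w ∈ monomialSpan hn hζ, a * w ∈ monomialSpan hn hζ}
  mul_mem' {a b} ha hb w hw := by rw [mul_assoc]; exact ha _ (hb _ hw)
  add_mem' {a b} ha hb w hw := by rw [add_mul]; exact Submodule.add_mem _ (ha _ hw) (hb _ hw)
  algebraMap_mem' c w hw := by rw [← Algebra.smul_def]; exact Submodule.smul_mem _ _ hw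

theorem mem_stabilizer {a : TaftAlgebra hn hζ}
    (h : ∀ i j, a * (K hn hζ ^ i * X hn hζ ^ j) ∈ monomialSpan hn hζ) : a ∈ stabilizer hn hζ := by
  intro w hw
  induction hw using Submodule.span_induction with
  | mem x hx => obtain ⟨p, rfl⟩ := hx; exact h _ _
  | zero => rw [mul_zero]; exact Submodule.zero_mem _
  | add x y _ _ hx hy => rw [mul_add]; exact Submodule.add_mem _ hx hy
  | smul c x _ hx => rw [mul_smul_comm]; exact Submodule.smul_mem _ _ hx

instance : Module.Finite k (TaftAlgebra hn hζ) := by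
  refine ⟨?_⟩
  have htop : monomialSpan hn hζ = ⊤ := by
    refine eq_top_iff.2 fun a _ => ?_
    have ha : a ∈ stabilizer hn hζ := mem_of_subalgebra hn hζ _
      (mem_stabilizer hn hζ fun i j => by
        rw [← mul_assoc, ← pow_succ']; exact monomial_mem hn hζ _ _)
      (mem_stabilizer hn hζ fun i j => by
        have h := K_pow_mul_X hn hζ i
        have h' : X hn hζ * K hn hζ ^ i = (ζ ^ i)⁻¹ • (K hn hζ ^ i * X hn hζ) := by
          rw [h, smul_smul, inv_mul_cancel₀ (pow_ne_zero _ (hζ.ne_zero (by omega))), one_smul]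
        rw [← mul_assoc, h', smul_mul_assoc, mul_assoc, ← pow_succ']
        exact Submodule.smul_mem _ _ (monomial_mem hn hζ _ _)) a
    simpa using ha 1 (by simpa using monomial_mem hn hζ 0 0)
  rw [← htop]
  exact Submodule.fg_span (Set.finite_range _)

/-- The operator `K` on sequences used to see that the integral is nonzero. -/
noncomputable def opK (ζ : k) : Module.End k (ℕ → k) :=
  LinearMap.pi fun i => ζ ^ (i + 1) • LinearMap.proj i

/-- The operator `X` on sequences: the shift, truncated at `n`. -/
noncomputable def opX (k : Type u) [Field k] (n : ℕ) : Module.End k (ℕ → k) :=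
  LinearMap.pi fun i => if 0 < i ∧ i < n then LinearMap.proj (i - 1) else 0

theorem opK_pow (ζ : k) (m : ℕ) (f : ℕ → k) (i : ℕ) :
    (opK ζ ^ m) f i = ζ ^ ((i + 1) * m) * f i := by
  induction m generalizing f with
  | zero => simp
  | succ m ih =>
    rw [pow_succ, Module.End.mul_apply, ih]
    simp [opK]; ring

theorem opX_pow (n m : ℕ) (f : ℕ → k) (i : ℕ) (hi : i < n) :
    (opX k n ^ m) f i = if m ≤ i then f (i - m) else 0 := by
  induction m generalizing f with
  | zero => simp
  | succ m ih =>
    rw [pow_succ, Module.End.mul_apply, ih]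
    by_cases h : m ≤ i
    · by_cases h' : m + 1 ≤ i
      · have h2 : 0 < i - m ∧ i - m < n := by omega
        rw [if_pos h, if_pos h']
        simp only [opX, LinearMap.pi_apply, if_pos h2, LinearMap.proj_apply]
        congr 1
      · have h2 : ¬ (0 < i - m ∧ i - m < n) := by omega
        rw [if_pos h, if_neg h']
        simp only [opX, LinearMap.pi_apply, if_neg h2, LinearMap.zero_apply]
    · rw [if_neg h, if_neg (by omega)]

/-- An action of the Taft algebra on sequences. -/
noncomputable def seqRep : TaftAlgebra hn hζ →ₐ[k] Module.End k (ℕ → k) :=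
  lift hn hζ (opK ζ) (opX k n)
    (by
      ext f i
      by_cases h : 0 < i ∧ i < n
      · obtain ⟨i, rfl⟩ : ∃ j, i = j + 1 := ⟨i - 1, by omega⟩
        simp [opK, opX, h.2]; ring
      · simp [opK, opX, h])
    (by
      ext f i
      rw [opK_pow, mul_comm (i + 1), pow_mul, hζ.pow_eq_one, one_pow, one_mul]; rfl)
    (by
      refine LinearMap.ext fun f => funext fun i => ?_
      by_cases hi : i < n
      · rw [opX_pow n n f i hi, if_neg (by omega)]; rfl
      · obtain ⟨m, rfl⟩ : ∃ m, n = m + 1 := ⟨n - 1, by omega⟩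
        rw [pow_succ', Module.End.mul_apply]
        have h2 : ¬ (0 < i ∧ i < m + 1) := fun h => hi h.2
        exact LinearMap.congr_fun (if_neg h2) _)

/-- The left integral `(1 + K + ⋯ + K^(n-1)) X^(n-1)` of the Taft algebra. -/
noncomputable def integral : LeftIntegral k (TaftAlgebra hn hζ) where
  elem := (∑ i ∈ Finset.range n, K hn hζ ^ i) * X hn hζ ^ (n - 1)
  ne_zero h0 := by
    have h1 := congrArg (fun a => seqRep hn hζ a (Pi.single 0 1) (n - 1)) h0
    have hlt : n - 1 < n := by omega
    have : NeZero n := ⟨by omega⟩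
    have := hζ.neZero'
    have e : ∀ i, ((opK ζ ^ i) ((opX k n ^ (n - 1)) (Pi.single 0 1))) (n - 1) = 1 := by
      intro i
      rw [opK_pow, opX_pow _ _ _ _ hlt, if_pos le_rfl, Nat.sub_add_cancel hn.le, pow_mul,
        hζ.pow_eq_one]
      simp
    simp [seqRep, Module.End.mul_apply, LinearMap.sum_apply, e] at h1
    exact NeZero.ne (n : k) h1
  mul_elem h := by
    refine mem_of_subalgebra hn hζ
      { carrier := {a | a * ((∑ i ∈ Finset.range n, K hn hζ ^ i) * X hn hζ ^ (n - 1)) =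
          counit (R := k) a • ((∑ i ∈ Finset.range n, K hn hζ ^ i) * X hn hζ ^ (n - 1))}
        mul_mem' := fun {a b} ha hb => ?_
        add_mem' := fun {a b} ha hb => ?_
        algebraMap_mem' := fun c => ?_ } ?_ ?_ h
    · change _ = _
      rw [mul_assoc, hb, mul_smul_comm, ha, smul_smul, Bialgebra.counit_mul, mul_comm]
    · change _ = _
      rw [add_mul, ha, hb, map_add, add_smul]
    · change _ = _
      rw [Bialgebra.counit_algebraMap, Algebra.smul_def]
    · change _ = _
      rw [counit_K, one_smul, ← mul_assoc]
      congr 1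
      have h1 := Finset.sum_range_succ (fun i => K hn hζ ^ i) n
      rw [Finset.sum_range_succ', K_pow, pow_zero] at h1
      rw [Finset.mul_sum, ← add_right_cancel h1]
      exact Finset.sum_congr rfl fun i _ => (pow_succ' _ _).symm
    · change _ = _
      rw [counit_X, zero_smul, ← mul_assoc, Finset.mul_sum, Finset.sum_mul]
      refine Finset.sum_eq_zero fun i _ => ?_
      have h' : X hn hζ * K hn hζ ^ i = (ζ ^ i)⁻¹ • (K hn hζ ^ i * X hn hζ) := by
        rw [K_pow_mul_X, smul_smul, inv_mul_cancel₀ (pow_ne_zero _ (hζ.ne_zero (by omega))),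
          one_smul]
      rw [h', smul_mul_assoc, mul_assoc, ← pow_succ', Nat.sub_add_cancel hn.le, X_pow, mul_zero,
        smul_zero]

end

end Taft

/-!
The cone of the first map of a short exact sequence `0 → L → M → N → 0` is stably isomorphic to
`N`: the kernel `H ⊗ L` of `C_u → N` is projective, by the Galois isomorphism, and it splits off
because monomorphisms split after tensoring with `H`. Hence a homomorphism out of the Grothendieck
group of the stable category is the same as a function that is additive on short exact sequences
and vanishes on projective modules.

A nonzero module over the Taft algebra contains an eigenvector of `K` killed by `X`, so additive
functions are determined by their values on the one-dimensional modules `k_i`, on which `K` acts by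
`ζ ^ i`. In a projective module the kernel of `X` is the image of `X ^ (n - 1)`, whence `X` cannot
lower the dimensions of the eigenspaces of `K` along the cycle `ℤ/n`, and they are all equal.
Therefore the character `∑ i, m_i q ^ i` of the operator `K` is a well-defined element of `R_n` on
stable classes. Conversely, one relation `∑ i, [k_i] = 0`, which comes from the projective module
of dimension `n`, is all that is needed to invert it.
-/

section LinearAlgebra

variable {K U V W : Type*} [DivisionRing K] [AddCommGroup U] [Module K U] [AddCommGroup V]
  [Module K V] [Module.Finite K V] [AddCommGroup W] [Module K W]

theorem finrank_eq_add_of_exact {f : U →ₗ[K] V} {g : V →ₗ[K] W} (hf : Function.Injective f)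
    (hfg : Function.Exact f g) (hg : Function.Surjective g) :
    Module.finrank K V = Module.finrank K U + Module.finrank K W := by
  rw [← LinearMap.finrank_range_add_finrank_ker g, LinearMap.range_eq_top.2 hg, finrank_top,
    LinearMap.exact_iff.1 hfg, LinearMap.finrank_range_of_inj hf, add_comm]

theorem finrank_le_of_ker_le_range [Module.Finite K W] {f : V →ₗ[K] W} {g : W →ₗ[K] V}
    (hle : LinearMap.ker f ≤ LinearMap.range g) (hgf : g ∘ₗ f = 0) :
    Module.finrank K V ≤ Module.finrank K W := by
  rw [← LinearMap.finrank_range_add_finrank_ker f, ← LinearMap.finrank_range_add_finrank_ker g,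
    add_comm]
  exact add_le_add (Submodule.finrank_mono hle)
    (Submodule.finrank_mono (LinearMap.range_le_ker_iff.2 hgf))

end LinearAlgebra

namespace FDMod

section Algebra

variable {k H : Type u} [Field k] [Ring H] [Algebra k H] {M N P Q W X Y Z : FDMod k H}

theorem toLin_comp_apply (f : X ⟶ Y) (g : Y ⟶ Z) (x : X.carrier) :
    Hom.toLin (f ≫ g) x = Hom.toLin g (Hom.toLin f x) := rfl

theorem toLin_id_apply (x : X.carrier) : Hom.toLin (𝟙 X) x = x := rfl

theorem hom_ext {f g : X ⟶ Y} (h : ∀ x, Hom.toLin f x = Hom.toLin g x) : f = g :=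
  Hom.ext (LinearMap.ext h)

theorem toLin_comp_eq_of_eq {f : X ⟶ Y} {g : Y ⟶ Z} {h : X ⟶ Z} (w : f ≫ g = h)
    (x : X.carrier) : Hom.toLin g (Hom.toLin f x) = Hom.toLin h x := by
  rw [← w, toLin_comp_apply]

theorem ρ_mul_apply (M : FDMod k H) (a b : H) (x : M.carrier) :
    M.ρ (a * b) x = M.ρ a (M.ρ b x) := by
  rw [map_mul, Module.End.mul_apply]

/-! ### The additive structure of the category of modules -/

instance : Zero (X ⟶ Y) := ⟨⟨0, fun _ _ => (map_zero _).symm⟩⟩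

instance : Add (X ⟶ Y) :=
  ⟨fun f g => ⟨Hom.toLin f + Hom.toLin g, fun h x => by simp [Hom.comm]⟩⟩

instance : Neg (X ⟶ Y) :=
  ⟨fun f => ⟨-Hom.toLin f, fun h x => by simp [Hom.comm]⟩⟩

theorem toLin_add (f g : X ⟶ Y) : Hom.toLin (f + g) = Hom.toLin f + Hom.toLin g := rfl

theorem toLin_neg (f : X ⟶ Y) : Hom.toLin (-f) = -Hom.toLin f := rfl

instance : AddCommGroup (X ⟶ Y) where
  add_assoc _ _ _ := Hom.ext (add_assoc _ _ _)
  zero_add _ := Hom.ext (zero_add _)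
  add_zero _ := Hom.ext (add_zero _)
  add_comm _ _ := Hom.ext (add_comm _ _)
  neg_add_cancel _ := Hom.ext (neg_add_cancel _)
  nsmul := nsmulRec
  zsmul := zsmulRec

theorem toLin_sub (f g : X ⟶ Y) : Hom.toLin (f - g) = Hom.toLin f - Hom.toLin g := by
  rw [sub_eq_add_neg, sub_eq_add_neg, toLin_add, toLin_neg]

instance : Preadditive (FDMod k H) where
  add_comp _ _ _ f g h := hom_ext fun _ => map_add (Hom.toLin h) _ _
  comp_add _ _ _ _ _ _ := hom_ext fun _ => rfl

/-- The first inclusion into a direct sum. -/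
def inl (X Y : FDMod k H) : X ⟶ prod X Y where
  toLin := LinearMap.inl k X.carrier Y.carrier
  comm h _ := Prod.ext rfl (map_zero (Y.ρ h)).symm

/-- The second inclusion into a direct sum. -/
def inr (X Y : FDMod k H) : Y ⟶ prod X Y where
  toLin := LinearMap.inr k X.carrier Y.carrier
  comm h _ := Prod.ext (map_zero (X.ρ h)).symm rfl

/-- The first projection from a direct sum. -/
def fst (X Y : FDMod k H) : prod X Y ⟶ X where
  toLin := LinearMap.fst k X.carrier Y.carrier
  comm _ _ := rfl

/-- The second projection from a direct sum. -/
def snd (X Y : FDMod k H) : prod X Y ⟶ Y where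
  toLin := LinearMap.snd k X.carrier Y.carrier
  comm _ _ := rfl

theorem fst_inl_add_snd_inr : fst X Y ≫ inl X Y + snd X Y ≫ inr X Y = 𝟙 (prod X Y) :=
  hom_ext fun x => LinearMap.congr_fun (LinearMap.coprod_inl_inr (R := k)) x

theorem lift_comp_desc (f : W ⟶ X) (f' : W ⟶ Y) (g : X ⟶ Z) (g' : Y ⟶ Z) :
    (f ≫ inl X Y + f' ≫ inr X Y) ≫ (fst X Y ≫ g + snd X Y ≫ g') = f ≫ g + f' ≫ g' := by
  refine hom_ext fun w => ?_
  change Hom.toLin g (Hom.toLin f w + 0) + Hom.toLin g' (0 + Hom.toLin f' w) = _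
  rw [add_zero, zero_add]
  rfl

/-! ### Short exact sequences -/

/-- `0 ⟶ X ⟶ Y ⟶ Z ⟶ 0` is an exact sequence of modules. -/
structure IsShortExact (f : X ⟶ Y) (g : Y ⟶ Z) : Prop where
  injective : Function.Injective (Hom.toLin f)
  exact : Function.Exact (Hom.toLin f) (Hom.toLin g)
  surjective : Function.Surjective (Hom.toLin g)

theorem isShortExact_coker {f : X ⟶ Y} (hf : Function.Injective (Hom.toLin f)) :
    IsShortExact f (cokerMk f) :=
  ⟨hf, LinearMap.exact_map_mkQ_range _, Submodule.mkQ_surjective _⟩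

theorem isShortExact_prod : IsShortExact (inl X Y) (snd X Y) :=
  ⟨LinearMap.inl_injective, Function.Exact.inl_snd, LinearMap.snd_surjective⟩

theorem IsShortExact.comp_eq_zero {f : X ⟶ Y} {g : Y ⟶ Z} (h : IsShortExact f g) :
    f ≫ g = 0 :=
  hom_ext h.exact.apply_apply_eq_zero

theorem IsShortExact.comp_left_cancel {f : X ⟶ Y} {g : Y ⟶ Z} (h : IsShortExact f g)
    {a b : Z ⟶ W} (hab : g ≫ a = g ≫ b) : a = b :=
  hom_ext fun z => by
    obtain ⟨y, rfl⟩ := h.surjective z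
    exact LinearMap.congr_fun (congrArg Hom.toLin hab) y

theorem IsShortExact.exists_desc {f : X ⟶ Y} {g : Y ⟶ Z} (h : IsShortExact f g) (a : Y ⟶ W)
    (w : f ≫ a = 0) : ∃ b : Z ⟶ W, g ≫ b = a := by
  have hker : LinearMap.ker (Hom.toLin g) ≤ LinearMap.ker (Hom.toLin a) := fun y hy => by
    obtain ⟨x, rfl⟩ := (h.exact y).1 hy
    exact toLin_comp_eq_of_eq w x
  let b := (LinearMap.ker (Hom.toLin g)).liftQ (Hom.toLin a) hker ∘ₗ
    ((Hom.toLin g).quotKerEquivOfSurjective h.surjective).symm.toLinearMap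
  have hb : ∀ y, b (Hom.toLin g y) = Hom.toLin a y := fun y => by
    have : ((Hom.toLin g).quotKerEquivOfSurjective h.surjective).symm (Hom.toLin g y) =
        Submodule.Quotient.mk y := by
      rw [LinearEquiv.symm_apply_eq]; rfl
    simp only [b, LinearMap.comp_apply, LinearEquiv.coe_coe, this, Submodule.liftQ_apply]
  refine ⟨⟨b, fun s z => ?_⟩, hom_ext hb⟩
  obtain ⟨y, rfl⟩ := h.surjective z
  rw [← Hom.comm, hb, hb, Hom.comm]

theorem IsShortExact.exists_section {f : X ⟶ Y} {g : Y ⟶ Z} (h : IsShortExact f g) {r : Y ⟶ X}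
    (hr : f ≫ r = 𝟙 X) : ∃ s : Z ⟶ Y, s ≫ g = 𝟙 Z ∧ g ≫ s = 𝟙 Y - r ≫ f := by
  obtain ⟨s, hs⟩ := h.exists_desc (𝟙 Y - r ≫ f) (by
    rw [Preadditive.comp_sub, Category.comp_id, reassoc_of% hr, sub_self])
  refine ⟨s, h.comp_left_cancel ?_, hs⟩
  rw [reassoc_of% hs, Preadditive.sub_comp, Category.assoc, h.comp_eq_zero, Limits.comp_zero,
    sub_zero, Category.id_comp, Category.comp_id]

/-- A function on modules is additive when it is additive on short exact sequences. -/
def IsAdditive {A : Type*} [Add A] (χ : FDMod k H → A) : Prop :=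
  ∀ ⦃X Y Z : FDMod k H⦄ ⦃f : X ⟶ Y⦄ ⦃g : Y ⟶ Z⦄, IsShortExact f g → χ Y = χ X + χ Z

section IsAdditive

variable {A : Type*} {χ : FDMod k H → A}

theorem IsAdditive.prod [Add A] (hχ : IsAdditive χ) (X Y : FDMod k H) :
    χ (FDMod.prod X Y) = χ X + χ Y :=
  hχ isShortExact_prod

theorem IsAdditive.eq_zero_of_subsingleton [AddLeftCancelMonoid A] (hχ : IsAdditive χ)
    (X : FDMod k H) [Subsingleton X.carrier] : χ X = 0 := by
  have h : IsShortExact (𝟙 X) (𝟙 X) :=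
    ⟨Function.injective_id, fun x => by simp [Subsingleton.elim _ x], Function.surjective_id⟩
  simpa using hχ h

theorem isAdditive_finrank : IsAdditive fun M : FDMod k H => Module.finrank k M.carrier :=
  fun _ _ _ _ _ h => finrank_eq_add_of_exact h.injective h.exact h.surjective

end IsAdditive

/-! ### Projective modules -/

theorem IsProjective.of_retract (hP : P.IsProjective) (i : Q ⟶ P) (p : P ⟶ Q)
    (h : i ≫ p = 𝟙 Q) : Q.IsProjective := by
  let _ : Module H P.carrier := Module.compHom P.carrier P.ρ.toRingHom
  let _ : Module H Q.carrier := Module.compHom Q.carrier Q.ρ.toRingHom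
  have : Module.Projective H P.carrier := hP
  exact Module.Projective.of_split (R := H)
    { Hom.toLin i with map_smul' := Hom.comm i } { Hom.toLin p with map_smul' := Hom.comm p }
    (LinearMap.ext (toLin_comp_eq_of_eq h))

theorem IsProjective.prod (hP : P.IsProjective) (hQ : Q.IsProjective) :
    (FDMod.prod P Q).IsProjective := by
  let _ : Module H P.carrier := Module.compHom P.carrier P.ρ.toRingHom
  let _ : Module H Q.carrier := Module.compHom Q.carrier Q.ρ.toRingHom
  have : Module.Projective H P.carrier := hP
  have : Module.Projective H Q.carrier := hQ
  let _ : Module H (FDMod.prod P Q).carrier :=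
    Module.compHom (FDMod.prod P Q).carrier (FDMod.prod P Q).ρ.toRingHom
  let e : (P.carrier × Q.carrier) ≃ₗ[H] (FDMod.prod P Q).carrier :=
    { AddEquiv.refl (FDMod.prod P Q).carrier with map_smul' := fun _ _ => rfl }
  exact Module.Projective.of_equiv e

theorem isProjective_of_subsingleton (P : FDMod k H) [Subsingleton P.carrier] :
    P.IsProjective := by
  let _ : Module H P.carrier := Module.compHom P.carrier P.ρ.toRingHom
  exact ⟨⟨0, fun x => Subsingleton.elim _ _⟩⟩

/-- The homomorphisms that factor through a projective module, that is, those that become zero in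
the stable category. -/
def FactorsThroughProjective (f : X ⟶ Y) : Prop :=
  ∃ (P : FDMod k H) (a : X ⟶ P) (b : P ⟶ Y), P.IsProjective ∧ f = a ≫ b

theorem stableRel_iff {f g : X ⟶ Y} :
    stableRel k H f g ↔ FactorsThroughProjective (f - g) := by
  simp only [stableRel, FactorsThroughProjective, ← toLin_sub]
  exact exists₃_congr fun P a b => and_congr_right fun _ => Hom.ext_iff.symm

namespace FactorsThroughProjective

theorem zero : FactorsThroughProjective (0 : X ⟶ Y) := by
  have : Subsingleton (coker (𝟙 X)).carrier :=
    Submodule.Quotient.subsingleton_iff.2 LinearMap.range_id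
  exact ⟨_, 0, 0, isProjective_of_subsingleton (coker (𝟙 X)), rfl⟩

theorem neg {f : X ⟶ Y} (hf : FactorsThroughProjective f) : FactorsThroughProjective (-f) := by
  obtain ⟨P, a, b, hP, rfl⟩ := hf
  exact ⟨P, -a, b, hP, (Preadditive.neg_comp _ _).symm⟩

theorem add {f g : X ⟶ Y} (hf : FactorsThroughProjective f) (hg : FactorsThroughProjective g) :
    FactorsThroughProjective (f + g) := by
  obtain ⟨P, a, b, hP, rfl⟩ := hf
  obtain ⟨Q, c, d, hQ, rfl⟩ := hg
  exact ⟨prod P Q, a ≫ inl P Q + c ≫ inr P Q, fst P Q ≫ b + snd P Q ≫ d, hP.prod hQ,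
    (lift_comp_desc a c b d).symm⟩

theorem sub {f g : X ⟶ Y} (hf : FactorsThroughProjective f) (hg : FactorsThroughProjective g) :
    FactorsThroughProjective (f - g) :=
  sub_eq_add_neg f g ▸ hf.add hg.neg

theorem comp_left {g : Y ⟶ Z} (hg : FactorsThroughProjective g) (f : X ⟶ Y) :
    FactorsThroughProjective (f ≫ g) := by
  obtain ⟨P, a, b, hP, rfl⟩ := hg
  exact ⟨P, f ≫ a, b, hP, (Category.assoc _ _ _).symm⟩

theorem comp_right {f : X ⟶ Y} (hf : FactorsThroughProjective f) (g : Y ⟶ Z) :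
    FactorsThroughProjective (f ≫ g) := by
  obtain ⟨P, a, b, hP, rfl⟩ := hf
  exact ⟨P, a, b ≫ g, hP, Category.assoc _ _ _⟩

end FactorsThroughProjective

theorem IsProjective.factorsThroughProjective_left (hP : P.IsProjective) (f : P ⟶ X) :
    FactorsThroughProjective f :=
  ⟨P, 𝟙 P, f, hP, (Category.id_comp f).symm⟩

theorem isProjective_of_factorsThroughProjective (h : FactorsThroughProjective (𝟙 X)) :
    X.IsProjective := by
  obtain ⟨P, a, b, hP, hab⟩ := h
  exact hP.of_retract a b hab.symm

instance : Congruence (stableRel k H) where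
  equivalence :=
    { refl := fun f => stableRel_iff.2 (sub_self f ▸ .zero)
      symm := fun {f g} h => stableRel_iff.2 (neg_sub f g ▸ (stableRel_iff.1 h).neg)
      trans := fun {f g e} h h' => stableRel_iff.2
        (sub_add_sub_cancel f g e ▸ (stableRel_iff.1 h).add (stableRel_iff.1 h')) }
  comp_left f _ _ h := stableRel_iff.2
    (Preadditive.comp_sub f _ _ ▸ (stableRel_iff.1 h).comp_left f)
  comp_right g h := stableRel_iff.2
    (Preadditive.sub_comp _ _ g ▸ (stableRel_iff.1 h).comp_right g)

section StableInvariance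

variable {A : Type*} [AddCommGroup A] {χ : FDMod k H → A}

theorem IsShortExact.isProjective_of_retract {f : X ⟶ Y} {g : Y ⟶ Z} (h : IsShortExact f g)
    {r : Y ⟶ X} (hr : f ≫ r = 𝟙 X) (hrf : FactorsThroughProjective (𝟙 Y - r ≫ f)) :
    Z.IsProjective := by
  obtain ⟨s, hsg, hgs⟩ := h.exists_section hr
  have hid : s ≫ (𝟙 Y - r ≫ f) ≫ g = 𝟙 Z := by
    rw [← hgs, Category.assoc, reassoc_of% hsg, hsg]
  exact isProjective_of_factorsThroughProjective (hid ▸ (hrf.comp_right _).comp_left s)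

theorem IsShortExact.exists_stable_inverse {f : X ⟶ Y} {g : Y ⟶ Z} (h : IsShortExact f g)
    (hX : X.IsProjective) {r : Y ⟶ X} (hr : f ≫ r = 𝟙 X) :
    ∃ s : Z ⟶ Y, s ≫ g = 𝟙 Z ∧ stableRel k H (g ≫ s) (𝟙 Y) := by
  obtain ⟨s, hsg, hgs⟩ := h.exists_section hr
  refine ⟨s, hsg, stableRel_iff.2 ?_⟩
  rw [hgs, sub_sub_cancel_left]
  exact (hX.factorsThroughProjective_left f).comp_left r |>.neg

/-- If `f ≫ g - 𝟙` factors as `a ≫ b` through `P`, then `(f, a)` embeds `M` as a direct summand of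
`N ⊕ P`, and its complement is projective. -/
theorem IsAdditive.eq_of_stableRel (hχ : IsAdditive χ)
    (hproj : ∀ P : FDMod k H, P.IsProjective → χ P = 0) {f : M ⟶ N} {g : N ⟶ M}
    (hfg : stableRel k H (f ≫ g) (𝟙 M)) (hgf : stableRel k H (g ≫ f) (𝟙 N)) : χ M = χ N := by
  obtain ⟨P, a, b, hP, hab⟩ := stableRel_iff.1 hfg
  let i := f ≫ inl N P + a ≫ inr N P
  let p := fst N P ≫ g + snd N P ≫ (-b)
  have hip : i ≫ p = 𝟙 M := by
    rw [lift_comp_desc, Preadditive.comp_neg, ← hab]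
    abel
  have hpi : 𝟙 _ - p ≫ i =
      snd N P ≫ (inr N P + b ≫ i) - fst N P ≫ (g ≫ f - 𝟙 N) ≫ inl N P -
        (fst N P ≫ g ≫ a) ≫ inr N P := by
    rw [← fst_inl_add_snd_inr]
    simp only [i, p, Preadditive.comp_add, Preadditive.add_comp, Preadditive.sub_comp,
      Preadditive.comp_sub, Preadditive.neg_comp, Preadditive.comp_neg,
      Category.assoc, Category.id_comp]
    abel
  have hi : IsShortExact i (cokerMk i) :=
    isShortExact_coker (Function.LeftInverse.injective (toLin_comp_eq_of_eq hip))
  have hQ : (coker i).IsProjective := hi.isProjective_of_retract hip <| hpi ▸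
    (((hP.factorsThroughProjective_left _).comp_left _).sub
      (((stableRel_iff.1 hgf).comp_right _).comp_left _)).sub
      ((hP.factorsThroughProjective_left _).comp_left _)
  have h := hχ hi
  rw [hχ.prod, hproj P hP, hproj _ hQ, add_zero, add_zero] at h
  exact h.symm

end StableInvariance

section Regular

variable [Module.Finite k H]

theorem isProjective_reg : (reg k H).IsProjective := by
  have h : (Module.compHom (reg k H).carrier (reg k H).ρ.toRingHom : Module H H) =
      (Semiring.toModule : Module H H) := by
    ext
    rfl
  unfold IsProjective
  rw [h]
  exact (inferInstance : Module.Projective H H)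

/-- The homomorphism `H → M`, `h ↦ h x`. -/
noncomputable def orbit (M : FDMod k H) (x : M.carrier) : reg k H ⟶ M where
  toLin := LinearMap.applyₗ x ∘ₗ M.ρ.toLinearMap
  comm a h := ρ_mul_apply M a h x

end Regular

/-- A projective module is a direct summand of a free one, so exactness passes from `H` to it. -/
theorem IsProjective.exists_ρ_apply_eq (hP : P.IsProjective) {a b : H}
    (h : ∀ x : H, a * x = 0 → ∃ y, b * y = x) {x : P.carrier} (hx : P.ρ a x = 0) :
    ∃ y, P.ρ b y = x := by
  let _ : Module H P.carrier := Module.compHom P.carrier P.ρ.toRingHom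
  have : Module.Projective H P.carrier := hP
  obtain ⟨s, hs⟩ := Module.Projective.out (R := H) (P := P.carrier)
  have hasx : a • s x = 0 := by
    rw [← map_smul, show a • x = 0 from hx, map_zero]
  choose y hy using fun p => h (s x p) (DFunLike.congr_fun hasx p)
  refine ⟨∑ p ∈ (s x).support, P.ρ (y p) p, ?_⟩
  rw [map_sum]
  conv_rhs => rw [← hs x, Finsupp.linearCombination_apply, Finsupp.sum]
  refine Finset.sum_congr rfl fun p _ => ?_
  rw [← ρ_mul_apply, hy]
  rfl

end Algebra

/-! ### Exactness of the tensor product -/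

section Bialgebra

variable {k H : Type u} [Field k] [Ring H] [Bialgebra k H] {X Y Z : FDMod k H}

theorem IsShortExact.tensor_right {f : X ⟶ Y} {g : Y ⟶ Z} (h : IsShortExact f g)
    (N : FDMod k H) : IsShortExact (tensorHom f (𝟙 N)) (tensorHom g (𝟙 N)) :=
  ⟨Module.Flat.rTensor_preserves_injective_linearMap _ h.injective,
    rTensor_exact N.carrier h.exact h.surjective,
    LinearMap.rTensor_surjective N.carrier h.surjective⟩

theorem IsShortExact.tensor_left {f : X ⟶ Y} {g : Y ⟶ Z} (h : IsShortExact f g)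
    (M : FDMod k H) : IsShortExact (tensorHom (𝟙 M) f) (tensorHom (𝟙 M) g) :=
  ⟨Module.Flat.lTensor_preserves_injective_linearMap _ h.injective,
    lTensor_exact M.carrier h.exact h.surjective,
    LinearMap.lTensor_surjective M.carrier h.surjective⟩

end Bialgebra

end FDMod

/-! ### The Galois map of a Hopf algebra -/

namespace FDMod

section Convolution

variable {k H V W : Type*} [CommRing k] [AddCommGroup H] [Module k H] [Coalgebra k H]
  [AddCommGroup V] [Module k V] [AddCommGroup W] [Module k W]

/-- The endomorphism `h ⊗ v ↦ ∑ h₁ ⊗ σ(h₂) v` of `H ⊗ V` given by a linear map `σ : H → End V`. -/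
noncomputable def coact (σ : H →ₗ[k] Module.End k V) : H ⊗[k] V →ₗ[k] H ⊗[k] V :=
  (TensorProduct.lift σ).lTensor H ∘ₗ (TensorProduct.assoc k H H V).toLinearMap ∘ₗ
    (comul (R := k)).rTensor V

theorem coact_tmul (σ : H →ₗ[k] Module.End k V) (h : H) (v : V) :
    coact σ (h ⊗ₜ v) = (σ.flip v).lTensor H (comul (R := k) h) := by
  simp only [coact, LinearMap.comp_apply, LinearMap.rTensor_tmul, LinearEquiv.coe_coe]
  induction comul (R := k) h using TensorProduct.induction_on with
  | zero => simp
  | add s t hs ht => simp only [TensorProduct.add_tmul, map_add, hs, ht]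
  | tmul a b => simp

theorem coact_comp_coact (σ τ : H →ₗ[k] Module.End k V) :
    coact σ ∘ₗ coact τ =
      coact (LinearMap.mul' k (Module.End k V) ∘ₗ TensorProduct.map σ τ ∘ₗ comul (R := k)) := by
  refine TensorProduct.ext' fun h v => ?_
  let ψ : H ⊗[k] H →ₗ[k] V :=
    (LinearMap.applyₗ v : Module.End k V →ₗ[k] V) ∘ₗ LinearMap.mul' k (Module.End k V) ∘ₗ
      TensorProduct.map σ τ
  have hψ : ∀ t : H ⊗[k] H, coact σ ((τ.flip v).lTensor H t) =
      ψ.lTensor H (TensorProduct.assoc k H H H ((comul (R := k)).rTensor H t)) := fun t => by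
    induction t using TensorProduct.induction_on with
    | zero => simp
    | add s t hs ht => simp only [map_add, hs, ht]
    | tmul a b =>
      simp only [LinearMap.lTensor_tmul, LinearMap.rTensor_tmul, coact_tmul]
      induction comul (R := k) a using TensorProduct.induction_on with
      | zero => simp
      | add s t hs ht => simp only [TensorProduct.add_tmul, map_add, hs, ht]
      | tmul c d => simp [ψ]
  rw [LinearMap.comp_apply, coact_tmul, hψ, Coalgebra.coassoc_apply, coact_tmul,
    ← LinearMap.lTensor_comp_apply]
  rfl

theorem coact_counit :
    coact ((counit (R := k) (A := H)).smulRight (1 : Module.End k V)) = LinearMap.id := by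
  refine TensorProduct.ext' fun h v => ?_
  have : (((counit (R := k) (A := H)).smulRight (1 : Module.End k V)).flip v) =
      LinearMap.toSpanSingleton k V v ∘ₗ counit (R := k) := LinearMap.ext fun _ => rfl
  rw [coact_tmul, this, LinearMap.lTensor_comp_apply, Coalgebra.lTensor_counit_comul]
  simp

theorem lTensor_coact {σ : H →ₗ[k] Module.End k V} {τ : H →ₗ[k] Module.End k W} {f : V →ₗ[k] W}
    (hf : ∀ h v, f (σ h v) = τ h (f v)) (z : H ⊗[k] V) :
    f.lTensor H (coact σ z) = coact τ (f.lTensor H z) := by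
  induction z using TensorProduct.induction_on with
  | zero => simp
  | add s t hs ht => simp only [map_add, hs, ht]
  | tmul h v =>
    rw [LinearMap.lTensor_tmul, coact_tmul, coact_tmul, ← LinearMap.lTensor_comp_apply]
    exact congrArg (fun φ => LinearMap.lTensor H φ _) (LinearMap.ext fun h => hf h v)

end Convolution

section Bialgebra

variable {k H V : Type*} [CommRing k] [Ring H] [Bialgebra k H] [AddCommGroup V] [Module k V]

theorem lTensor_flip_mul (ρ : H →ₐ[k] Module.End k V) (s t : H ⊗[k] H) (v : V) :
    (ρ.toLinearMap.flip v).lTensor H (s * t) =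
      Module.endTensorEndAlgHom (R := k) (S := k) (A := k)
        (Algebra.TensorProduct.map (Algebra.lmul k H) ρ s)
        ((ρ.toLinearMap.flip v).lTensor H t) := by
  induction s using TensorProduct.induction_on with
  | zero => simp
  | add s s' hs hs' => simp only [add_mul, map_add, LinearMap.add_apply, hs, hs']
  | tmul a b =>
    induction t using TensorProduct.induction_on with
    | zero => simp
    | add t t' ht ht' => simp only [mul_add, map_add, ht, ht']
    | tmul c d =>
      rw [Algebra.TensorProduct.tmul_mul_tmul, LinearMap.lTensor_tmul, LinearMap.flip_apply,
        AlgHom.toLinearMap_apply, map_mul]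
      rfl

theorem coact_rTensor_mulLeft (ρ : H →ₐ[k] Module.End k V) (h : H) (z : H ⊗[k] V) :
    coact ρ.toLinearMap ((Algebra.lmul k H h).rTensor V z) =
      Module.endTensorEndAlgHom (R := k) (S := k) (A := k)
        (Algebra.TensorProduct.map (Algebra.lmul k H) ρ (comul (R := k) h))
        (coact ρ.toLinearMap z) := by
  induction z using TensorProduct.induction_on with
  | zero => simp
  | add s t hs ht => simp only [map_add, hs, ht]
  | tmul a v =>
    rw [LinearMap.rTensor_tmul, coact_tmul, coact_tmul, ← lTensor_flip_mul, ← Bialgebra.comul_mul]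
    rfl

end Bialgebra

section Free

variable {k H : Type u} [Field k] [Ring H] [Algebra k H] [Module.Finite k H]

/-- The free module `H ⊗ V` on a finite-dimensional vector space `V`. -/
noncomputable def free (k H : Type u) [Field k] [Ring H] [Algebra k H] [Module.Finite k H]
    (V : Type u) [AddCommGroup V] [Module k V] [Module.Finite k V] : FDMod k H where
  carrier := H ⊗[k] V
  ρ := (Module.End.rTensorAlgHom k H V).comp (Algebra.lmul k H)

theorem isProjective_free (V : Type u) [AddCommGroup V] [Module k V] [Module.Finite k V] :
    (free k H V).IsProjective := by
  let _ : Module H (free k H V).carrier :=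
    Module.compHom (free k H V).carrier (free k H V).ρ.toRingHom
  have hsmul : ∀ (h : H) (z : H ⊗[k] V), h • z = (free k H V).ρ h z := fun h z => by
    induction z using TensorProduct.induction_on with
    | zero => exact (smul_zero h).trans (map_zero ((free k H V).ρ h)).symm
    | add s t hs ht =>
      exact (smul_add h s t).trans
        ((congrArg₂ (· + ·) hs ht).trans (map_add ((free k H V).ρ h) s t).symm)
    | tmul a v => rfl
  let e : (H ⊗[k] V) ≃ₗ[H] (free k H V).carrier :=
    { AddEquiv.refl (free k H V).carrier with map_smul' := hsmul }
  exact Module.Projective.of_equiv e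

/-- The homomorphism of free modules induced by a linear map. -/
noncomputable def freeMap {V W : Type u} [AddCommGroup V] [Module k V] [Module.Finite k V]
    [AddCommGroup W] [Module k W] [Module.Finite k W] (f : V →ₗ[k] W) :
    free k H V ⟶ free k H W where
  toLin := f.lTensor H
  comm _ z := LinearMap.congr_fun
    ((LinearMap.lTensor_comp_rTensor ..).trans (LinearMap.rTensor_comp_lTensor ..).symm) z

end Free

section Hopf

variable {k H : Type u} [Field k] [Ring H] [HopfAlgebra k H]

theorem mul'_map_ρ (M : FDMod k H) (σ τ : H →ₗ[k] H) (t : H ⊗[k] H) :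
    LinearMap.mul' k (Module.End k M.carrier)
      (TensorProduct.map (M.ρ.toLinearMap ∘ₗ σ) (M.ρ.toLinearMap ∘ₗ τ) t) =
      M.ρ (LinearMap.mul' k H (TensorProduct.map σ τ t)) := by
  induction t using TensorProduct.induction_on with
  | zero => simp
  | add s t hs ht => simp only [map_add, hs, ht]
  | tmul a b => simp

theorem coact_comp_coact_eq_id (M : FDMod k H) {σ τ : H →ₗ[k] H}
    (h : ∀ a, LinearMap.mul' k H (TensorProduct.map σ τ (comul (R := k) a)) =
      algebraMap k H (counit a)) :
    coact (M.ρ.toLinearMap ∘ₗ σ) ∘ₗ coact (M.ρ.toLinearMap ∘ₗ τ) = LinearMap.id := by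
  rw [coact_comp_coact, ← coact_counit]
  refine congrArg coact (LinearMap.ext fun a => ?_)
  refine (mul'_map_ρ M σ τ _).trans ?_
  rw [h, AlgHom.commutes, LinearMap.smulRight_apply, Algebra.algebraMap_eq_smul_one]

theorem coact_ρ_comp_coact_antipode (M : FDMod k H) :
    coact M.ρ.toLinearMap ∘ₗ coact (M.ρ.toLinearMap ∘ₗ HopfAlgebra.antipode k) =
      LinearMap.id :=
  coact_comp_coact_eq_id M (σ := LinearMap.id) HopfAlgebra.mul_antipode_lTensor_comul_apply

theorem coact_antipode_comp_coact_ρ (M : FDMod k H) :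
    coact (M.ρ.toLinearMap ∘ₗ HopfAlgebra.antipode k) ∘ₗ coact M.ρ.toLinearMap =
      LinearMap.id :=
  coact_comp_coact_eq_id M (τ := LinearMap.id) HopfAlgebra.mul_antipode_rTensor_comul_apply

variable [Module.Finite k H]

/-- The homomorphism `H ⊗ M → H ⊗ M`, `h ⊗ m ↦ ∑ h₁ ⊗ h₂ m`, from the free module to the tensor
product. -/
noncomputable def twist (M : FDMod k H) : free k H M.carrier ⟶ tensor (reg k H) M where
  toLin := coact M.ρ.toLinearMap
  comm := coact_rTensor_mulLeft M.ρ

/-- The inverse `h ⊗ m ↦ ∑ h₁ ⊗ S(h₂) m` of `twist`. -/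
noncomputable def untwist (M : FDMod k H) : tensor (reg k H) M ⟶ free k H M.carrier where
  toLin := (coact (M.ρ.toLinearMap ∘ₗ HopfAlgebra.antipode k) :
    H ⊗[k] M.carrier →ₗ[k] H ⊗[k] M.carrier)
  comm h (z : H ⊗[k] M.carrier) := by
    let φ := coact (M.ρ.toLinearMap ∘ₗ HopfAlgebra.antipode k)
    have hleft (w) : φ (coact M.ρ.toLinearMap w) = w :=
      LinearMap.congr_fun (coact_antipode_comp_coact_ρ M) w
    have hright (w) : coact M.ρ.toLinearMap (φ w) = w :=
      LinearMap.congr_fun (coact_ρ_comp_coact_antipode M) w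
    exact ((congrArg (fun w => φ ((tensor (reg k H) M).ρ h w)) (hright z)).symm.trans
      (congrArg φ (Hom.comm (twist M) h (φ z)).symm)).trans (hleft _)

theorem untwist_twist (M : FDMod k H) : untwist M ≫ twist M = 𝟙 (tensor (reg k H) M) :=
  Hom.ext (coact_ρ_comp_coact_antipode M)

theorem tensorHom_untwist {M N : FDMod k H} (u : M ⟶ N) :
    tensorHom (𝟙 (reg k H)) u ≫ untwist N = untwist M ≫ freeMap (Hom.toLin u) :=
  have h := lTensor_coact (σ := M.ρ.toLinearMap ∘ₗ HopfAlgebra.antipode k)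
    (τ := N.ρ.toLinearMap ∘ₗ HopfAlgebra.antipode k) (f := Hom.toLin u)
    (fun h => Hom.comm u (HopfAlgebra.antipode k h))
  hom_ext fun z => (h z).symm

theorem isProjective_reg_tensor (M : FDMod k H) : (tensor (reg k H) M).IsProjective :=
  (isProjective_free M.carrier).of_retract (untwist M) (twist M) (untwist_twist M)

/-- As a free module, `H ⊗ M` is a direct summand of `H ⊗ N` once `M` is a subspace of `N`. -/
theorem exists_retraction_reg_tensor {M N : FDMod k H} {u : M ⟶ N}
    (hu : Function.Injective (Hom.toLin u)) :
    ∃ r : tensor (reg k H) N ⟶ tensor (reg k H) M, tensorHom (𝟙 (reg k H)) u ≫ r = 𝟙 _ := by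
  obtain ⟨ψ, hψ⟩ := (Hom.toLin u).exists_leftInverse_of_injective (LinearMap.ker_eq_bot.2 hu)
  refine ⟨untwist N ≫ freeMap ψ ≫ twist M, ?_⟩
  have hfree : freeMap (H := H) (Hom.toLin u) ≫ freeMap ψ = 𝟙 _ := Hom.ext <| by
    change ψ.lTensor H ∘ₗ (Hom.toLin u).lTensor H = LinearMap.id
    rw [← LinearMap.lTensor_comp, hψ, LinearMap.lTensor_id]
  rw [reassoc_of% tensorHom_untwist u, reassoc_of% hfree, untwist_twist]

end Hopf

end FDMod

/-! ### Classes in the Grothendieck group -/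

namespace StMod

open FDMod

variable {k H : Type u} [Field k] [Ring H] [HopfAlgebra k H] [Module.Finite k H]
variable (Λ : LeftIntegral k H)

theorem embed_injective (M : FDMod k H) : Function.Injective (Hom.toLin (embed Λ M)) := by
  refine (injective_iff_map_eq_zero _).2 fun x hx => ?_
  obtain ⟨φ, hφ⟩ := Module.Projective.exists_dual_ne_zero k Λ.ne_zero
  let F : H ⊗[k] M.carrier →ₗ[k] M.carrier :=
    (TensorProduct.lid k M.carrier).toLinearMap ∘ₗ LinearMap.rTensor M.carrier φ
  have hF : φ Λ.elem • x = 0 := (congrArg F hx).trans (map_zero F)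
  exact (smul_eq_zero.1 hF).resolve_left hφ

theorem comp_embed {M N : FDMod k H} (u : M ⟶ N) :
    u ≫ embed Λ N = embed Λ M ≫ tensorHom (𝟙 (reg k H)) u := rfl

/-- `H ⊗ M` is injective relative to `u`, because `H ⊗ M → H ⊗ N` splits. -/
theorem exists_comp_eq_embed {M N : FDMod k H} {u : M ⟶ N}
    (hu : Function.Injective (Hom.toLin u)) :
    ∃ r : N ⟶ tensor (reg k H) M, u ≫ r = embed Λ M := by
  obtain ⟨r, hr⟩ := exists_retraction_reg_tensor hu
  exact ⟨embed Λ N ≫ r, by rw [← Category.assoc, comp_embed, Category.assoc, hr, Category.comp_id]⟩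

theorem isShortExact_pushoutHom {M N : FDMod k H} (u : M ⟶ N) :
    IsShortExact (pushoutHom Λ u) (cokerMk (pushoutHom Λ u)) :=
  isShortExact_coker fun _ _ h => embed_injective Λ M (neg_injective (congrArg Prod.snd h))

/-- The homomorphism `H ⊗ M → C_u` opposite to `u` in the pushout square. -/
noncomputable def coneInr {M N : FDMod k H} (u : M ⟶ N) : tensor (reg k H) M ⟶ cone Λ u :=
  inr N _ ≫ cokerMk (pushoutHom Λ u)

/-- The homomorphism out of the cone of `u` given by the universal property of the pushout. -/
noncomputable def coneDesc {M N P : FDMod k H} (u : M ⟶ N) (f : N ⟶ P)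
    (g : tensor (reg k H) M ⟶ P) (w : u ≫ f = embed Λ M ≫ g) : cone Λ u ⟶ P :=
  cokerDesc (pushoutHom Λ u) (fst N _ ≫ f + snd N _ ≫ g) fun x => by
    change Hom.toLin f (Hom.toLin u x) + Hom.toLin g (-Hom.toLin (embed Λ M) x) = 0
    rw [map_neg, toLin_comp_eq_of_eq w, toLin_comp_apply, add_neg_cancel]

theorem coneInr_coneDesc {M N P : FDMod k H} (u : M ⟶ N) (f : N ⟶ P)
    (g : tensor (reg k H) M ⟶ P) (w : u ≫ f = embed Λ M ≫ g) :
    coneInr Λ u ≫ coneDesc Λ u f g w = g :=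
  hom_ext fun z => by
    change Hom.toLin f 0 + Hom.toLin g z = Hom.toLin g z
    rw [map_zero, zero_add]

theorem isShortExact_coneInr {M N P : FDMod k H} {u : M ⟶ N} {v : N ⟶ P}
    (h : IsShortExact u v) :
    IsShortExact (coneInr Λ u) (coneDesc Λ u v 0 (h.comp_eq_zero.trans Limits.comp_zero.symm)) where
  injective := by
    refine (injective_iff_map_eq_zero _).2 fun z hz => ?_
    obtain ⟨x, hx⟩ := (Submodule.Quotient.mk_eq_zero _).1 hz
    have hx0 : x = 0 := h.injective ((congrArg Prod.fst hx).trans (map_zero _).symm)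
    have hz : z = -Hom.toLin (embed Λ M) x := (congrArg Prod.snd hx).symm
    rw [hz, hx0, map_zero, neg_zero]
  exact e := by
    refine ⟨fun he => ?_, ?_⟩
    · obtain ⟨⟨y, z⟩, rfl⟩ := Submodule.mkQ_surjective _ e
      have hy : Hom.toLin v y + 0 = 0 := he
      obtain ⟨x, rfl⟩ := (h.exact y).1 ((add_zero _).symm.trans hy)
      refine ⟨z + Hom.toLin (embed Λ M) x, (Submodule.Quotient.eq _).2 ⟨-x, ?_⟩⟩
      refine Prod.ext ?_ ?_
      · change Hom.toLin u (-x) = 0 - Hom.toLin u x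
        rw [map_neg, zero_sub]
      · change -Hom.toLin (embed Λ M) (-x) = z + Hom.toLin (embed Λ M) x - z
        rw [map_neg, neg_neg, add_sub_cancel_left]
    · rintro ⟨z, rfl⟩
      exact toLin_comp_eq_of_eq (coneInr_coneDesc Λ u v 0 _) z
  surjective z := by
    obtain ⟨y, rfl⟩ := h.surjective z
    exact ⟨Hom.toLin (coneIn Λ u) y, add_zero _⟩

/-- The kernel `H ⊗ M` of `C_u → P` is projective and splits off. -/
theorem nonempty_iso_cone {M N P : FDMod k H} {u : M ⟶ N} {v : N ⟶ P}
    (h : IsShortExact u v) : Nonempty (of P ≅ of (cone Λ u)) := by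
  obtain ⟨r, hr⟩ := exists_comp_eq_embed Λ h.injective
  obtain ⟨s, hs, hs'⟩ := (isShortExact_coneInr Λ h).exists_stable_inverse
    (isProjective_reg_tensor M)
    (coneInr_coneDesc Λ u r (𝟙 _) (hr.trans (Category.comp_id _).symm))
  exact ⟨⟨res s, res _, congrArg res hs, CategoryTheory.Quotient.sound _ hs'⟩⟩

theorem shiftMap_id (M : FDMod k H) : shiftMap Λ (𝟙 M) = 𝟙 (shift Λ M) :=
  Hom.ext TensorProduct.map_id

theorem cls_eq_of_isDistinguished {A B C : StMod k H} {f : A ⟶ B} {g : B ⟶ C}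
    {h : C ⟶ of (shift Λ A.as)} (hd : IsDistinguished Λ f g h) :
    cls Λ B = cls Λ A + cls Λ C := by
  refine sub_eq_zero.1 ((QuotientAddGroup.eq_zero_iff (FreeAbelianGroup.of B -
    (FreeAbelianGroup.of A + FreeAbelianGroup.of C))).2 (AddSubgroup.subset_closure ?_))
  exact ⟨A, B, C, f, g, h, hd, rfl⟩

theorem cls_eq_of_iso_cone {M N C : FDMod k H} (u : M ⟶ N) (c : of C ≅ of (cone Λ u)) :
    cls Λ (of N) = cls Λ (of M) + cls Λ (of C) := by
  have h1 : res (𝟙 M) = 𝟙 (of M) := rfl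
  refine cls_eq_of_isDistinguished Λ (f := res u) (g := res (coneIn Λ u) ≫ c.inv)
    (h := c.hom ≫ res (coneOut Λ u)) ⟨M, N, u, 𝟙 M, Iso.refl _, c, ?_, ?_, ?_, ?_⟩
  · rw [h1]; infer_instance
  · rw [h1]
    exact (Category.comp_id _).trans (Category.id_comp _).symm
  · rw [Category.assoc, c.inv_hom_id]
    exact (Category.comp_id _).trans (Category.id_comp _).symm
  · rw [shiftMap_id]
    exact Category.comp_id _

theorem isAdditive_cls : IsAdditive fun M : FDMod k H => cls Λ (of M) :=
  fun _ _ _ u _ h => cls_eq_of_iso_cone Λ u (nonempty_iso_cone Λ h).some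

/-- All projective modules are zero objects of the stable category. -/
def isoOfIsProjective {P Q : FDMod k H} (hP : P.IsProjective) (hQ : Q.IsProjective) :
    of P ≅ of Q where
  hom := res 0
  inv := res 0
  hom_inv_id := CategoryTheory.Quotient.sound _
    (stableRel_iff.2 (hP.factorsThroughProjective_left _))
  inv_hom_id := CategoryTheory.Quotient.sound _
    (stableRel_iff.2 (hQ.factorsThroughProjective_left _))

theorem cls_eq_zero_of_isProjective {P : FDMod k H} (hP : P.IsProjective) :
    cls Λ (of P) = 0 := by
  have : Subsingleton (coker (𝟙 P)).carrier :=
    Submodule.Quotient.subsingleton_iff.2 LinearMap.range_id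
  have hexact : IsShortExact (𝟙 P) (cokerMk (𝟙 P)) := isShortExact_coker Function.injective_id
  obtain ⟨e⟩ := nonempty_iso_cone Λ hexact
  exact left_eq_add.1 (cls_eq_of_iso_cone Λ (𝟙 P)
    (isoOfIsProjective hP (isProjective_of_subsingleton _) ≪≫ e))

variable {Λ}

theorem eq_add_of_isDistinguished {A : Type*} [AddCommGroup A] {χ : FDMod k H → A}
    (hχ : IsAdditive χ) (hproj : ∀ P : FDMod k H, P.IsProjective → χ P = 0)
    {X Y Z : StMod k H} {f : X ⟶ Y} {g : Y ⟶ Z} {h : Z ⟶ of (shift Λ X.as)}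
    (hd : IsDistinguished Λ f g h) : χ Y.as = χ X.as + χ Z.as := by
  have hiso {X Y : StMod k H} (e : X ≅ Y) : χ X.as = χ Y.as := by
    obtain ⟨f, hf⟩ := (Quotient.functor (stableRel k H)).map_surjective
      (X := X.as) (Y := Y.as) e.hom
    obtain ⟨g, hg⟩ := (Quotient.functor (stableRel k H)).map_surjective
      (X := Y.as) (Y := X.as) e.inv
    exact hχ.eq_of_stableRel hproj
      ((Quotient.functor_map_eq_iff _ _ _).1 (by
        rw [Functor.map_comp, hf, hg]; exact e.hom_inv_id))
      ((Quotient.functor_map_eq_iff _ _ _).1 (by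
        rw [Functor.map_comp, hf, hg]; exact e.inv_hom_id))
  obtain ⟨X', Y', u, a, b, c, ha, -⟩ := hd
  have hcone := hχ (isShortExact_pushoutHom Λ u)
  rw [hχ.prod, hproj _ (isProjective_reg_tensor X'), add_zero] at hcone
  exact (hiso b).trans (hcone.trans
    (congrArg₂ (· + ·) (hiso (asIso (res a))).symm (hiso c).symm))

/-- The homomorphism out of the Grothendieck group induced by an additive function that vanishes
on projective modules. -/
noncomputable def lift {A : Type*} [AddCommGroup A] (χ : FDMod k H → A) (hχ : IsAdditive χ)
    (hproj : ∀ P : FDMod k H, P.IsProjective → χ P = 0) : GrothendieckGroup Λ →+ A :=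
  QuotientAddGroup.lift _ (FreeAbelianGroup.lift fun X => χ X.as) (by
    rw [AddSubgroup.closure_le]
    rintro _ ⟨X, Y, Z, f, g, h, hd, rfl⟩
    change FreeAbelianGroup.lift _ _ = 0
    simp only [map_sub, map_add, FreeAbelianGroup.lift_apply_of,
      eq_add_of_isDistinguished hχ hproj hd, sub_self])

theorem lift_cls {A : Type*} [AddCommGroup A] {χ : FDMod k H → A} (hχ : IsAdditive χ)
    (hproj : ∀ P : FDMod k H, P.IsProjective → χ P = 0) (X : StMod k H) :
    lift χ hχ hproj (cls Λ X) = χ X.as :=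
  FreeAbelianGroup.lift_apply_of _ _

theorem mem_of_cls_mem (S : AddSubgroup (GrothendieckGroup Λ)) (h : ∀ A, cls Λ A ∈ S)
    (x : GrothendieckGroup Λ) : x ∈ S := by
  obtain ⟨x, rfl⟩ := QuotientAddGroup.mk_surjective x
  induction x using FreeAbelianGroup.induction_on with
  | zero => exact S.zero_mem
  | of A => exact h A
  | neg A hA => exact S.neg_mem hA
  | add x y hx hy => exact S.add_mem hx hy

theorem hom_ext {B : Type*} [AddCommGroup B] {f g : GrothendieckGroup Λ →+ B}
    (h : ∀ A, f (cls Λ A) = g (cls Λ A)) : f = g :=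
  AddMonoidHom.ext (mem_of_cls_mem (f.eqLocus g) h)

theorem eq_of_biadditive {m m' : GrothendieckGroup Λ → GrothendieckGroup Λ → GrothendieckGroup Λ}
    (hl : ∀ x y z, m x (y + z) = m x y + m x z) (hr : ∀ x y z, m (x + y) z = m x z + m y z)
    (hl' : ∀ x y z, m' x (y + z) = m' x y + m' x z)
    (hr' : ∀ x y z, m' (x + y) z = m' x z + m' y z)
    (h : ∀ A B, m (cls Λ A) (cls Λ B) = m' (cls Λ A) (cls Λ B)) : m = m' := by
  have h1 : ∀ A y, m (cls Λ A) y = m' (cls Λ A) y := fun A =>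
    DFunLike.congr_fun (hom_ext (f := AddMonoidHom.mk' (m (cls Λ A)) (hl _))
      (g := AddMonoidHom.mk' (m' (cls Λ A)) (hl' _)) (h A))
  exact funext fun x => funext fun y => DFunLike.congr_fun
    (hom_ext (f := AddMonoidHom.mk' (fun x => m x y) fun _ _ => hr _ _ _)
      (g := AddMonoidHom.mk' (fun x => m' x y) fun _ _ => hr' _ _ _) fun A => h1 A y) x

theorem IsGrothendieckRing.mul_add {r : Ring (GrothendieckGroup Λ)} (h : IsGrothendieckRing Λ r)
    (x y z : GrothendieckGroup Λ) : r.mul x ((groupStructure Λ).add y z) =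
      (groupStructure Λ).add (r.mul x y) (r.mul x z) :=
  (congrArg (r.mul x) (h.add_eq y z).symm).trans ((r.left_distrib x y z).trans (h.add_eq _ _))

theorem IsGrothendieckRing.add_mul {r : Ring (GrothendieckGroup Λ)} (h : IsGrothendieckRing Λ r)
    (x y z : GrothendieckGroup Λ) : r.mul ((groupStructure Λ).add x y) z =
      (groupStructure Λ).add (r.mul x z) (r.mul y z) :=
  (congrArg (fun w => r.mul w z) (h.add_eq x y).symm).trans
    ((r.right_distrib x y z).trans (h.add_eq _ _))

theorem IsGrothendieckRing.unique {r r' : Ring (GrothendieckGroup Λ)}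
    (h : IsGrothendieckRing Λ r) (h' : IsGrothendieckRing Λ r') : r = r' := by
  refine Ring.ext (funext fun x => funext fun y => (h.add_eq x y).trans (h'.add_eq x y).symm)
    (eq_of_biadditive h.mul_add h.add_mul h'.mul_add h'.add_mul fun A B => ?_)
  exact (h.mul_eq A.as B.as).trans (h'.mul_eq A.as B.as).symm

end StMod

theorem pow_apply_of_apply_eq_smul {R V : Type*} [CommSemiring R] [AddCommMonoid V] [Module R V]
    {f : Module.End R V} {c : R} {x : V} (h : f x = c • x) (m : ℕ) : (f ^ m) x = c ^ m • x := by
  induction m with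
  | zero => simp
  | succ m ih => rw [pow_succ', Module.End.mul_apply, ih, map_smul, h, smul_smul, pow_succ]

namespace Taft

section EigenIdem

variable {k : Type*} [Field k] {n : ℕ} [NeZero n] {ζ : k} (hζ : IsPrimitiveRoot ζ n)
  {A V : Type*} [Ring A] [Algebra k A] [AddCommGroup V] [Module k V]

/-- The character `i ↦ ζ ^ i` of `ℤ/n`. -/
noncomputable def chi : AddChar (ZMod n) k := AddChar.zmodChar n hζ.pow_eq_one

theorem chi_one : chi hζ 1 = ζ := by
  simpa [chi] using AddChar.zmodChar_apply' hζ.pow_eq_one 1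

theorem chi_pow_val (i j : ZMod n) : chi hζ i ^ j.val = chi hζ (i * j) := by
  rw [← AddChar.map_nsmul_eq_pow, nsmul_eq_mul, ZMod.natCast_zmod_val, mul_comm]

theorem chi_pow_card (i : ZMod n) : chi hζ i ^ n = 1 := by
  rw [← AddChar.map_nsmul_eq_pow, nsmul_eq_mul, CharP.cast_eq_zero, zero_mul,
    AddChar.map_zero_eq_one]

theorem sum_chi_mul (b : ZMod n) :
    ∑ a, chi hζ (a * b) = if b = 0 then (n : k) else 0 := by
  have h := AddChar.sum_mulShift b (AddChar.zmodChar_primitive_of_primitive_root n hζ)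
  rw [ZMod.card] at h
  exact_mod_cast h

/-- For `g ^ n = 1`, the idempotent of `k[g]` that projects every `k[g]`-module onto the
`ζ ^ i`-eigenspace of `g`. -/
noncomputable def eigenIdem (g : A) (i : ZMod n) : A :=
  (n : k)⁻¹ • ∑ j : ZMod n, chi hζ (-(i * j)) • g ^ j.val

theorem mul_eigenIdem {g : A} (hg : g ^ n = 1) (i : ZMod n) :
    g * eigenIdem hζ g i = chi hζ i • eigenIdem hζ g i := by
  rw [eigenIdem, mul_smul_comm, smul_comm]
  congr 1
  rw [Finset.mul_sum, Finset.smul_sum]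
  refine Fintype.sum_equiv (Equiv.addLeft (1 : ZMod n)) _ _ fun j => ?_
  have hpow : g ^ (1 + j).val = g * g ^ j.val := by
    rw [ZMod.val_add, ← pow_eq_pow_mod _ hg, pow_add, ZMod.val_one_eq_one_mod,
      ← pow_eq_pow_mod _ hg, pow_one]
  rw [mul_smul_comm, Equiv.coe_addLeft, hpow, smul_smul, ← AddChar.map_add_eq_mul]
  congr 2
  ring

theorem sum_eigenIdem (g : A) : ∑ i, eigenIdem hζ g i = 1 := by
  have := hζ.neZero'
  have hsum (j : ZMod n) :
      ∑ i, chi hζ (-(i * j)) • g ^ j.val = if j = 0 then (n : k) • (1 : A) else 0 := by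
    rw [← Finset.sum_smul]
    simp only [← mul_neg, sum_chi_mul, neg_eq_zero]
    split_ifs with h
    · rw [h, ZMod.val_zero, pow_zero]
    · rw [zero_smul]
  simp only [eigenIdem]
  rw [← Finset.smul_sum, Finset.sum_comm]
  simp only [hsum, Finset.sum_ite_eq', Finset.mem_univ, if_true]
  rw [smul_smul, inv_mul_cancel₀ (NeZero.ne _), one_smul]

theorem map_eigenIdem_apply (ρ : A →ₐ[k] Module.End k V) {g : A} {x : V} {i : ZMod n}
    (hx : ρ g x = chi hζ i • x) (j : ZMod n) :
    ρ (eigenIdem hζ g j) x = if j = i then x else 0 := by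
  have := hζ.neZero'
  have hpow (m : ℕ) : ρ (g ^ m) x = chi hζ i ^ m • x := by
    rw [map_pow, pow_apply_of_apply_eq_smul hx]
  have hchi (a : ZMod n) :
      chi hζ (-(j * a)) * chi hζ (i * a) = chi hζ (a * (i - j)) := by
    rw [← AddChar.map_add_eq_mul]
    ring_nf
  simp only [eigenIdem, map_smul, map_sum, LinearMap.smul_apply, LinearMap.sum_apply, hpow,
    chi_pow_val, smul_smul, hchi]
  rw [← Finset.sum_smul, sum_chi_mul, smul_smul]
  simp only [sub_eq_zero, eq_comm (a := i)]
  split_ifs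
  · rw [inv_mul_cancel₀ (NeZero.ne _), one_smul]
  · rw [mul_zero, zero_smul]

theorem eigenIdem_mul_of_mul_eq_smul {g x : A} {i : ZMod n} (hx : g * x = chi hζ i • x)
    (j : ZMod n) : eigenIdem hζ g j * x = if j = i then x else 0 :=
  map_eigenIdem_apply hζ (Algebra.lmul k A) hx j

theorem eq_of_mul_eigenIdem_eq {g a b : A} (h : ∀ i, a * eigenIdem hζ g i = b * eigenIdem hζ g i) :
    a = b := by
  rw [← mul_one a, ← mul_one b, ← sum_eigenIdem hζ g, Finset.mul_sum, Finset.mul_sum]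
  exact Finset.sum_congr rfl fun i _ => h i

end EigenIdem

section Weights

variable {k : Type u} [Field k] {n : ℕ} [NeZero n] {ζ : k} {hn : 1 < n}
  {hζ : IsPrimitiveRoot ζ n}

theorem K_mul_eigenIdem (i : ZMod n) :
    K hn hζ * eigenIdem hζ (K hn hζ) i = chi hζ i • eigenIdem hζ (K hn hζ) i :=
  mul_eigenIdem hζ (K_pow hn hζ) i

theorem map_K_map_X_apply {V : Type*} [AddCommGroup V] [Module k V]
    (ρ : TaftAlgebra hn hζ →ₐ[k] Module.End k V) {x : V} {i : ZMod n}
    (hx : ρ (K hn hζ) x = chi hζ i • x) :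
    ρ (K hn hζ) (ρ (X hn hζ) x) = chi hζ (i + 1) • ρ (X hn hζ) x := by
  rw [← Module.End.mul_apply, ← map_mul, K_mul_X, map_smul, map_mul, LinearMap.smul_apply,
    Module.End.mul_apply, hx, map_smul, smul_smul, add_comm, AddChar.map_add_eq_mul, chi_one]

theorem X_mul_eigenIdem (i : ZMod n) :
    X hn hζ * eigenIdem hζ (K hn hζ) i = eigenIdem hζ (K hn hζ) (i + 1) * X hn hζ := by
  refine eq_of_mul_eigenIdem_eq hζ (g := K hn hζ) fun j => ?_
  rw [mul_assoc, mul_assoc, eigenIdem_mul_of_mul_eq_smul hζ (K_mul_eigenIdem j),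
    eigenIdem_mul_of_mul_eq_smul hζ (x := X hn hζ * _)
      (map_K_map_X_apply (Algebra.lmul k _) (K_mul_eigenIdem j))]
  simp only [add_left_inj, mul_ite, mul_zero]

theorem X_pow_mul_eigenIdem (i : ZMod n) (m : ℕ) :
    X hn hζ ^ m * eigenIdem hζ (K hn hζ) i = eigenIdem hζ (K hn hζ) (i + m) * X hn hζ ^ m := by
  induction m with
  | zero => simp
  | succ m ih =>
    rw [pow_succ', mul_assoc, ih, ← mul_assoc, X_mul_eigenIdem, mul_assoc, ← pow_succ',
      Nat.cast_succ, add_assoc]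

end Weights

end Taft

namespace Taft

open FDMod

variable {k : Type u} [Field k] {n : ℕ} {ζ : k} {hn : 1 < n} {hζ : IsPrimitiveRoot ζ n}
  {M N : FDMod k (TaftAlgebra hn hζ)}

/-- A linear map that commutes with `K` and `X` is a homomorphism of modules. -/
def homOfGenerators (f : M.carrier →ₗ[k] N.carrier)
    (hK : ∀ x, f (M.ρ (K hn hζ) x) = N.ρ (K hn hζ) (f x))
    (hX : ∀ x, f (M.ρ (X hn hζ) x) = N.ρ (X hn hζ) (f x)) : M ⟶ N where
  toLin := f
  comm h := mem_of_subalgebra hn hζ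
    { carrier := {h | ∀ x, f (M.ρ h x) = N.ρ h (f x)}
      mul_mem' := fun {a b} ha hb x => by rw [ρ_mul_apply, ρ_mul_apply, ha, hb]
      add_mem' := fun {a b} ha hb x => by
        rw [map_add, map_add, LinearMap.add_apply, LinearMap.add_apply, map_add, ha, hb]
      algebraMap_mem' := fun c x => by
        rw [AlgHom.commutes, AlgHom.commutes, Module.algebraMap_end_apply,
          Module.algebraMap_end_apply, map_smul] } hK hX h

theorem exists_ρ_X_eq_zero (M : FDMod k (TaftAlgebra hn hζ)) [Nontrivial M.carrier] :
    ∃ x ≠ 0, M.ρ (X hn hζ) x = 0 := by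
  by_contra! h
  obtain ⟨x, hx⟩ := exists_ne (0 : M.carrier)
  have hpow (m : ℕ) : M.ρ (X hn hζ ^ m) x ≠ 0 := by
    induction m with
    | zero => simpa using hx
    | succ m ih => rw [pow_succ', ρ_mul_apply]; exact h _ ih
  exact hpow n (by rw [X_pow, map_zero, LinearMap.zero_apply])

variable [NeZero n]

section WeightSpaces

/-- The `ζ ^ i`-eigenspace of `K`. -/
noncomputable abbrev weightSpace (M : FDMod k (TaftAlgebra hn hζ)) (i : ZMod n) :
    Submodule k M.carrier :=
  Module.End.eigenspace (M.ρ (K hn hζ)) (chi hζ i)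

theorem mem_weightSpace {x : M.carrier} {i : ZMod n} :
    x ∈ weightSpace M i ↔ M.ρ (K hn hζ) x = chi hζ i • x :=
  Module.End.mem_eigenspace_iff

theorem ρ_eigenIdem_mem (M : FDMod k (TaftAlgebra hn hζ)) (i : ZMod n) (x : M.carrier) :
    M.ρ (eigenIdem hζ (K hn hζ) i) x ∈ weightSpace M i := by
  rw [mem_weightSpace, ← ρ_mul_apply, K_mul_eigenIdem, map_smul, LinearMap.smul_apply]

theorem ρ_eigenIdem_apply {x : M.carrier} {i : ZMod n} (hx : x ∈ weightSpace M i) :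
    M.ρ (eigenIdem hζ (K hn hζ) i) x = x := by
  rw [map_eigenIdem_apply hζ M.ρ (mem_weightSpace.1 hx), if_pos rfl]

theorem exists_ρ_eigenIdem_ne_zero {x : M.carrier} (hx : x ≠ 0) :
    ∃ i, M.ρ (eigenIdem hζ (K hn hζ) i) x ≠ 0 := by
  by_contra! h
  have hsum := congrArg (fun a => M.ρ a x) (sum_eigenIdem hζ (K hn hζ))
  simp only [map_sum, LinearMap.sum_apply, h, Finset.sum_const_zero, map_one,
    Module.End.one_apply] at hsum
  exact hx hsum.symm

theorem ρ_X_mem {x : M.carrier} {i : ZMod n} (hx : x ∈ weightSpace M i) :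
    M.ρ (X hn hζ) x ∈ weightSpace M (i + 1) :=
  mem_weightSpace.2 (map_K_map_X_apply M.ρ (mem_weightSpace.1 hx))

theorem ρ_X_pow_mem {x : M.carrier} {i : ZMod n} (hx : x ∈ weightSpace M i) (m : ℕ) :
    M.ρ (X hn hζ ^ m) x ∈ weightSpace M (i + m) := by
  induction m with
  | zero => simpa using hx
  | succ m ih =>
    rw [pow_succ', ρ_mul_apply, Nat.cast_succ, ← add_assoc]
    exact ρ_X_mem ih

/-- The multiplicity of `ζ ^ i` as an eigenvalue of `K`. -/
noncomputable def mult (M : FDMod k (TaftAlgebra hn hζ)) (i : ZMod n) : ℕ :=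
  Module.finrank k (weightSpace M i)

theorem toLin_mem_weightSpace (f : M ⟶ N) {i : ZMod n} {x : M.carrier}
    (hx : x ∈ weightSpace M i) : Hom.toLin f x ∈ weightSpace N i := by
  rw [mem_weightSpace] at hx ⊢
  rw [← Hom.comm, hx, map_smul]

theorem isAdditive_mult (i : ZMod n) :
    IsAdditive fun M : FDMod k (TaftAlgebra hn hζ) => mult M i := by
  intro L M N f g h
  refine finrank_eq_add_of_exact
    (f := (Hom.toLin f).restrict fun _ => toLin_mem_weightSpace f)
    (g := (Hom.toLin g).restrict fun _ => toLin_mem_weightSpace g)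
    (fun x y hxy => Subtype.ext (h.injective (congrArg Subtype.val hxy)))
    (fun y => ⟨fun hy => ?_, ?_⟩) fun z => ?_
  · obtain ⟨x, hx⟩ := (h.exact y).1 (congrArg Subtype.val hy)
    refine ⟨⟨_, ρ_eigenIdem_mem L i x⟩, Subtype.ext ?_⟩
    exact (Hom.comm f _ x).trans ((congrArg _ hx).trans (ρ_eigenIdem_apply y.2))
  · rintro ⟨x, rfl⟩
    exact Subtype.ext (h.exact.apply_apply_eq_zero _)
  · obtain ⟨y, hy⟩ := h.surjective z
    refine ⟨⟨_, ρ_eigenIdem_mem M i y⟩, Subtype.ext ?_⟩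
    exact (Hom.comm g _ y).trans ((congrArg _ hy).trans (ρ_eigenIdem_apply z.2))

theorem mult_of_scalar {i : ZMod n} (h : ∀ x, M.ρ (K hn hζ) x = chi hζ i • x) (j : ZMod n) :
    mult M j = if j = i then Module.finrank k M.carrier else 0 := by
  split_ifs with hj
  · have htop : weightSpace M j = ⊤ := eq_top_iff.2 fun x _ => mem_weightSpace.2 (hj ▸ h x)
    rw [mult, htop, finrank_top]
  · have hbot : weightSpace M j = ⊥ := (Submodule.eq_bot_iff _).2 fun x hx => by
      rw [← ρ_eigenIdem_apply hx, map_eigenIdem_apply hζ M.ρ (h x), if_neg hj]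
    rw [mult, hbot, finrank_bot]

end WeightSpaces

section OneDim

/-- The one-dimensional module on which `K` acts by `ζ ^ i` and `X` by `0`. -/
noncomputable def oneDim (hn : 1 < n) (hζ : IsPrimitiveRoot ζ n) (i : ZMod n) :
    FDMod k (TaftAlgebra hn hζ) where
  carrier := k
  ρ := (Algebra.lmul k k).comp <| lift hn hζ (chi hζ i) 0 (by rw [mul_zero, zero_mul, smul_zero])
    (chi_pow_card hζ i) (zero_pow (NeZero.ne n))

theorem ρ_K_oneDim (i : ZMod n) (c : (oneDim hn hζ i).carrier) :
    (oneDim hn hζ i).ρ (K hn hζ) c = chi hζ i • c := by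
  change lift hn hζ _ _ _ _ _ (K hn hζ) * (show k from c) = chi hζ i * (show k from c)
  rw [lift_K]

theorem ρ_X_oneDim (i : ZMod n) (c : (oneDim hn hζ i).carrier) :
    (oneDim hn hζ i).ρ (X hn hζ) c = 0 := by
  change lift hn hζ _ _ _ _ _ (X hn hζ) * (show k from c) = (0 : k)
  rw [lift_X, zero_mul]

theorem finrank_oneDim (i : ZMod n) : Module.finrank k (oneDim hn hζ i).carrier = 1 :=
  Module.finrank_self k

theorem mult_oneDim (i j : ZMod n) : mult (oneDim hn hζ i) j = if j = i then 1 else 0 := by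
  rw [mult_of_scalar (ρ_K_oneDim i), finrank_oneDim]

/-- The homomorphism `c ↦ c v` for `v` in the kernel of `X` of weight `i`. -/
noncomputable def oneDimDesc {i : ZMod n} {v : M.carrier} (hv : v ∈ weightSpace M i)
    (hX : M.ρ (X hn hζ) v = 0) : oneDim hn hζ i ⟶ M :=
  let f : (oneDim hn hζ i).carrier →ₗ[k] M.carrier := LinearMap.toSpanSingleton k M.carrier v
  have hXc (c : k) : M.ρ (X hn hζ) (c • v) = 0 := by rw [map_smul, hX, smul_zero]
  homOfGenerators f
    (fun c => by
      rw [ρ_K_oneDim, map_smul]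
      exact (mem_weightSpace.1 (Submodule.smul_mem _ (show k from c) hv)).symm)
    (fun c => by
      rw [ρ_X_oneDim, map_zero]
      exact (hXc c).symm)

theorem exists_oneDim_injective (M : FDMod k (TaftAlgebra hn hζ)) [Nontrivial M.carrier] :
    ∃ (i : ZMod n) (u : oneDim hn hζ i ⟶ M), Function.Injective (Hom.toLin u) := by
  obtain ⟨x, hx, hXx⟩ := exists_ρ_X_eq_zero M
  obtain ⟨i, hi⟩ := exists_ρ_eigenIdem_ne_zero hx
  have hX : M.ρ (X hn hζ) (M.ρ (eigenIdem hζ (K hn hζ) i) x) = 0 := by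
    rw [← ρ_mul_apply, X_mul_eigenIdem, ρ_mul_apply, hXx, map_zero]
  exact ⟨i, oneDimDesc (ρ_eigenIdem_mem M i x) hX, smul_left_injective k hi⟩

theorem eq_of_eq_oneDim {A : Type*} [AddLeftCancelMonoid A]
    {χ χ' : FDMod k (TaftAlgebra hn hζ) → A} (hχ : IsAdditive χ) (hχ' : IsAdditive χ')
    (h : ∀ i, χ (oneDim hn hζ i) = χ' (oneDim hn hζ i)) (M : FDMod k (TaftAlgebra hn hζ)) :
    χ M = χ' M := by
  induction hd : Module.finrank k M.carrier using Nat.strong_induction_on generalizing M with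
  | _ d ih =>
    rcases subsingleton_or_nontrivial M.carrier with _ | _
    · rw [hχ.eq_zero_of_subsingleton, hχ'.eq_zero_of_subsingleton]
    · obtain ⟨i, u, hu⟩ := exists_oneDim_injective M
      have hex := isShortExact_coker hu
      have hlt : Module.finrank k (coker u).carrier < d := by
        have hfin := isAdditive_finrank hex
        simp only [finrank_oneDim] at hfin
        omega
      rw [hχ hex, hχ' hex, h, ih _ hlt _ rfl]

theorem sum_mult (M : FDMod k (TaftAlgebra hn hζ)) :
    ∑ i, mult M i = Module.finrank k M.carrier := by
  refine eq_of_eq_oneDim (χ := fun M => ∑ i, mult M i) (fun _ _ _ _ _ h => ?_)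
    isAdditive_finrank (fun i => ?_) M
  · exact (Finset.sum_congr rfl fun i _ => isAdditive_mult i h).trans Finset.sum_add_distrib
  · simp only [mult_oneDim, Finset.sum_ite_eq', Finset.mem_univ, if_true, finrank_oneDim]

end OneDim

end Taft

/-! ### The indecomposable projective modules -/

theorem eq_of_forall_le_add_one {n : ℕ} [NeZero n] {α : Type*} [PartialOrder α] {f : ZMod n → α}
    (h : ∀ i, f i ≤ f (i + 1)) (i j : ZMod n) : f i = f j := by
  have hm (i : ZMod n) (m : ℕ) : f i ≤ f (i + m) := by
    induction m with
    | zero => rw [Nat.cast_zero, add_zero]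
    | succ m ih => exact ih.trans (by simpa only [Nat.cast_succ, add_assoc] using h (i + m))
  have hle (i j : ZMod n) : f i ≤ f j := by
    simpa only [ZMod.natCast_zmod_val, add_sub_cancel] using hm i (j - i).val
  exact (hle i j).antisymm (hle j i)

namespace Taft

open FDMod

section StringVec

variable (k : Type*) [Field k] (n : ℕ) {V : Type*} [AddCommGroup V] [Module k V]

/-- The standard basis of `k ^ n`, indexed by `ℕ` and extended by zero from `n` on. -/
def stringVec (m : ℕ) : Fin n → k := fun j => if j.val = m then 1 else 0

variable {k n}

theorem stringVec_eq_single (j : Fin n) : stringVec k n j = Pi.single j 1 :=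
  funext fun l => by simp only [stringVec, Pi.single_apply, Fin.ext_iff]

theorem stringVec_eq_zero {m : ℕ} (hm : n ≤ m) : stringVec k n m = 0 :=
  funext fun l => if_neg (l.isLt.trans_le hm).ne

theorem string_ext {f g : (Fin n → k) →ₗ[k] V}
    (h : ∀ m, f (stringVec k n m) = g (stringVec k n m)) : f = g :=
  LinearMap.pi_ext' fun j => LinearMap.ext_ring (by simpa [stringVec_eq_single] using h j)

/-- The linear map that sends the basis of `k ^ n` to the first `n` terms of a sequence. -/
def stringLin (v : ℕ → V) : (Fin n → k) →ₗ[k] V := Fintype.linearCombination k fun j : Fin n => v j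

theorem stringLin_stringVec {v : ℕ → V} (hv : ∀ m, n ≤ m → v m = 0) (m : ℕ) :
    stringLin v (stringVec k n m) = v m := by
  rcases lt_or_ge m n with hm | hm
  · lift m to Fin n using hm
    rw [stringVec_eq_single, stringLin, Fintype.linearCombination_apply_single, one_smul]
  · rw [stringVec_eq_zero hm, map_zero, hv m hm]

variable (k n) in
/-- The truncated shift. -/
def stringX : Module.End k (Fin n → k) := stringLin fun m => stringVec k n (m + 1)

theorem stringX_stringVec (m : ℕ) : stringX k n (stringVec k n m) = stringVec k n (m + 1) :=
  stringLin_stringVec (fun _ hm => stringVec_eq_zero (hm.trans (Nat.le_succ _))) m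

theorem stringX_pow_stringVec (a m : ℕ) :
    (stringX k n ^ a) (stringVec k n m) = stringVec k n (m + a) := by
  induction a with
  | zero => rfl
  | succ a ih => rw [pow_succ', Module.End.mul_apply, ih, stringX_stringVec, add_assoc]

theorem stringX_pow : stringX k n ^ n = 0 :=
  string_ext fun m => by
    rw [stringX_pow_stringVec, stringVec_eq_zero (Nat.le_add_left n m), LinearMap.zero_apply]

theorem stringX_apply_succ (f : Fin n → k) {j : ℕ} (hj : j + 1 < n) :
    stringX k n f ⟨j + 1, hj⟩ = f ⟨j, j.lt_succ_self.trans hj⟩ := by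
  simp only [stringX, stringLin, Fintype.linearCombination_apply, stringVec, Finset.sum_apply,
    Pi.smul_apply, add_left_inj, smul_eq_mul, mul_ite, mul_one, mul_zero]
  rw [Finset.sum_eq_single ⟨j, j.lt_succ_self.trans hj⟩ _ (by simp)]
  · rw [if_pos rfl]
  · exact fun l _ hl => if_neg fun h => hl (Fin.ext h.symm)

theorem exists_stringX_pow_eq [NeZero n] {f : Fin n → k} (hf : stringX k n f = 0) :
    ∃ g, (stringX k n ^ (n - 1)) g = f := by
  have hn := NeZero.pos n
  let l : Fin n := ⟨n - 1, Nat.sub_lt hn one_pos⟩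
  refine ⟨f l • stringVec k n 0, funext fun j => ?_⟩
  rw [map_smul, stringX_pow_stringVec, zero_add, stringVec_eq_single l, Pi.smul_apply,
    Pi.single_apply]
  split_ifs with h
  · rw [h, smul_eq_mul, mul_one]
  · have hj : j.val + 1 < n := by
      have := Fin.val_ne_of_ne h
      have := j.isLt
      simp only [l] at *
      omega
    rw [smul_zero, ← stringX_apply_succ f hj, hf, Pi.zero_apply]

end StringVec

section StringMod

variable {k : Type u} [Field k] {n : ℕ} {ζ : k} {hn : 1 < n} {hζ : IsPrimitiveRoot ζ n}
  {M P : FDMod k (TaftAlgebra hn hζ)}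

theorem stringLin_ρ_X_pow (v : M.carrier) (m : ℕ) :
    stringLin (n := n) (fun m => M.ρ (X hn hζ ^ m) v) (stringVec k n m) =
      M.ρ (X hn hζ ^ m) v :=
  stringLin_stringVec
    (fun m hm => by rw [pow_eq_zero_of_le hm (X_pow hn hζ), map_zero, LinearMap.zero_apply]) m

variable [NeZero n]

/-- The diagonal operator with eigenvalues `ζ ^ i, ζ ^ (i + 1), …`. -/
noncomputable def stringK (hζ : IsPrimitiveRoot ζ n) (i : ZMod n) : Module.End k (Fin n → k) :=
  stringLin fun m => chi hζ (i + m) • stringVec k n m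

theorem stringK_stringVec (i : ZMod n) (m : ℕ) :
    stringK hζ i (stringVec k n m) = chi hζ (i + m) • stringVec k n m :=
  stringLin_stringVec (fun m hm => by rw [stringVec_eq_zero hm, smul_zero]) m

theorem stringK_pow (i : ZMod n) : stringK hζ i ^ n = 1 := by
  refine string_ext fun m => ?_
  rw [pow_apply_of_apply_eq_smul (stringK_stringVec i m), chi_pow_card, one_smul,
    Module.End.one_apply]

theorem stringK_mul_stringX (i : ZMod n) :
    stringK hζ i * stringX k n = ζ • (stringX k n * stringK hζ i) :=
  string_ext fun m => by
    rw [LinearMap.smul_apply, Module.End.mul_apply, Module.End.mul_apply, stringX_stringVec,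
      stringK_stringVec, stringK_stringVec, map_smul, stringX_stringVec, smul_smul, Nat.cast_succ,
      ← add_assoc, AddChar.map_add_eq_mul, chi_one, mul_comm]

/-- The indecomposable projective module with basis `w, X w, …, X ^ (n - 1) w`, where
`K w = ζ ^ i w`. -/
noncomputable abbrev stringMod (hn : 1 < n) (hζ : IsPrimitiveRoot ζ n) (i : ZMod n) :
    FDMod k (TaftAlgebra hn hζ) where
  carrier := Fin n → k
  ρ := lift hn hζ (stringK hζ i) (stringX k n) (stringK_mul_stringX i) (stringK_pow i) stringX_pow

theorem ρ_K_stringMod (i : ZMod n) : (stringMod hn hζ i).ρ (K hn hζ) = stringK hζ i :=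
  lift_K hn hζ _ _ (stringK_mul_stringX i) (stringK_pow i) stringX_pow

theorem ρ_X_stringMod (i : ZMod n) : (stringMod hn hζ i).ρ (X hn hζ) = stringX k n :=
  lift_X hn hζ _ _ (stringK_mul_stringX i) (stringK_pow i) stringX_pow

theorem ρ_X_pow_stringMod (i : ZMod n) (m : ℕ) :
    (stringMod hn hζ i).ρ (X hn hζ ^ m) = stringX k n ^ m := by
  rw [map_pow, ρ_X_stringMod]

theorem stringVec_zero_mem (i : ZMod n) :
    stringVec k n 0 ∈ weightSpace (stringMod hn hζ i) i := by
  rw [mem_weightSpace, ρ_K_stringMod, stringK_stringVec, Nat.cast_zero, add_zero]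

/-- The homomorphism that sends the generator of the string to a vector of weight `i`. -/
noncomputable def stringDesc {i : ZMod n} {v : M.carrier} (hv : v ∈ weightSpace M i) :
    stringMod hn hζ i ⟶ M :=
  let f : (Fin n → k) →ₗ[k] M.carrier := stringLin fun m => M.ρ (X hn hζ ^ m) v
  have hK : f ∘ₗ stringK hζ i = M.ρ (K hn hζ) ∘ₗ f := string_ext fun m => by
    rw [LinearMap.comp_apply, LinearMap.comp_apply, stringK_stringVec, map_smul,
      stringLin_ρ_X_pow, mem_weightSpace.1 (ρ_X_pow_mem hv m)]
  have hX : f ∘ₗ stringX k n = M.ρ (X hn hζ) ∘ₗ f := string_ext fun m => by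
    rw [LinearMap.comp_apply, LinearMap.comp_apply, stringX_stringVec, stringLin_ρ_X_pow,
      stringLin_ρ_X_pow, pow_succ', ρ_mul_apply]
  homOfGenerators (M := stringMod hn hζ i) f
    (by rw [ρ_K_stringMod]; exact LinearMap.congr_fun hK)
    (by rw [ρ_X_stringMod]; exact LinearMap.congr_fun hX)

theorem stringDesc_stringVec {i : ZMod n} {v : M.carrier} (hv : v ∈ weightSpace M i) (m : ℕ) :
    Hom.toLin (stringDesc hv) (stringVec k n m) = M.ρ (X hn hζ ^ m) v :=
  stringLin_ρ_X_pow v m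

theorem toLin_stringDesc_ρ_zero {i : ZMod n} {v : M.carrier} (hv : v ∈ weightSpace M i)
    (h : TaftAlgebra hn hζ) :
    Hom.toLin (stringDesc hv) ((stringMod hn hζ i).ρ h (stringVec k n 0)) = M.ρ h v := by
  rw [Hom.comm, stringDesc_stringVec, pow_zero, map_one, Module.End.one_apply]

theorem eigenIdem_mem_weightSpace_reg (i : ZMod n) :
    eigenIdem hζ (K hn hζ) i ∈ weightSpace (reg k (TaftAlgebra hn hζ)) i :=
  mem_weightSpace.2 (K_mul_eigenIdem i)

theorem isProjective_stringMod (i : ZMod n) : (stringMod hn hζ i).IsProjective := by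
  have he := eigenIdem_mem_weightSpace_reg (hn := hn) (hζ := hζ) i
  let p := orbit (stringMod hn hζ i) (stringVec k n 0)
  refine isProjective_reg.of_retract (stringDesc he) p
    (hom_ext (LinearMap.congr_fun (string_ext fun m => ?_)))
  refine (congrArg (Hom.toLin p) (stringDesc_stringVec he m)).trans ?_
  change (stringMod hn hζ i).ρ (X hn hζ ^ m * eigenIdem hζ (K hn hζ) i) (stringVec k n 0) = _
  rw [ρ_mul_apply, ρ_eigenIdem_apply (stringVec_zero_mem i), ρ_X_pow_stringMod,
    stringX_pow_stringVec, zero_add, toLin_id_apply]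

theorem exists_X_pow_mul_eq {h : TaftAlgebra hn hζ} (hh : X hn hζ * h = 0) :
    ∃ y, X hn hζ ^ (n - 1) * y = h := by
  have hi (i : ZMod n) : ∃ y, X hn hζ ^ (n - 1) * y = h * eigenIdem hζ (K hn hζ) i := by
    obtain ⟨g, hg⟩ : ∃ g, (stringX k n ^ (n - 1)) g =
        (stringMod hn hζ i).ρ h (stringVec k n 0) := by
      refine exists_stringX_pow_eq ?_
      rw [← ρ_X_stringMod (hn := hn) i, ← ρ_mul_apply, hh, map_zero, LinearMap.zero_apply]
    let u := stringDesc (eigenIdem_mem_weightSpace_reg (hn := hn) (hζ := hζ) i)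
    rw [← ρ_X_pow_stringMod (hn := hn) (hζ := hζ) i] at hg
    exact ⟨Hom.toLin u g, (Hom.comm u _ g).symm.trans
      ((congrArg _ hg).trans (toLin_stringDesc_ρ_zero _ h))⟩
  choose y hy using hi
  exact ⟨∑ i, y i, by rw [Finset.mul_sum, Finset.sum_congr rfl fun i _ => hy i, ← Finset.mul_sum,
    sum_eigenIdem, mul_one]⟩

theorem exists_ρ_X_pow_eq (hP : P.IsProjective) {x : P.carrier}
    (hx : P.ρ (X hn hζ) x = 0) : ∃ y, P.ρ (X hn hζ ^ (n - 1)) y = x :=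
  hP.exists_ρ_apply_eq (fun _ => exists_X_pow_mul_eq) hx

theorem mult_le_mult_add_one (hP : P.IsProjective) (i : ZMod n) :
    mult P i ≤ mult P (i + 1) := by
  have hcycle : i + 1 + (n - 1 : ℕ) = i := by
    rw [Nat.cast_sub hn.le, CharP.cast_eq_zero, Nat.cast_one, zero_sub, add_neg_cancel_right]
  refine finrank_le_of_ker_le_range
    (f := (P.ρ (X hn hζ)).restrict (p := weightSpace P i) (q := weightSpace P (i + 1))
      fun _ => ρ_X_mem)
    (g := (P.ρ (X hn hζ ^ (n - 1))).restrict (p := weightSpace P (i + 1)) (q := weightSpace P i)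
      fun x hx => hcycle ▸ ρ_X_pow_mem hx (n - 1)) (fun x hx => ?_) (LinearMap.ext fun x => ?_)
  · obtain ⟨y, hy⟩ := exists_ρ_X_pow_eq hP (x := x) (congrArg Subtype.val hx)
    refine ⟨⟨_, ρ_eigenIdem_mem P (i + 1) y⟩, Subtype.ext ?_⟩
    change P.ρ (X hn hζ ^ (n - 1)) (P.ρ _ y) = x
    rw [← ρ_mul_apply, X_pow_mul_eigenIdem, hcycle, ρ_mul_apply, hy, ρ_eigenIdem_apply x.2]
  · refine Subtype.ext ?_
    change P.ρ (X hn hζ ^ (n - 1)) (P.ρ (X hn hζ) x) = 0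
    rw [← ρ_mul_apply, pow_sub_one_mul (NeZero.ne n), X_pow, map_zero, LinearMap.zero_apply]

theorem mult_eq_of_isProjective (hP : P.IsProjective) (i j : ZMod n) : mult P i = mult P j :=
  eq_of_forall_le_add_one (mult_le_mult_add_one hP) i j

theorem mult_stringMod_zero (i : ZMod n) : mult (stringMod hn hζ 0) i = 1 := by
  have hsum := sum_mult (stringMod hn hζ 0)
  rw [Finset.sum_congr rfl fun j _ => mult_eq_of_isProjective (isProjective_stringMod 0) j i,
    Finset.sum_const, Finset.card_univ, ZMod.card, Module.finrank_fin_fun, smul_eq_mul] at hsum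
  exact Nat.eq_of_mul_eq_mul_left (NeZero.pos n) (hsum.trans (mul_one n).symm)

end StringMod

end Taft

/-! ### The ring `R_n` -/

theorem sum_zmod_eq_sum_range {n : ℕ} [NeZero n] {A : Type*} [AddCommMonoid A] (f : ZMod n → A) :
    ∑ i, f i = ∑ i ∈ Finset.range n, f i :=
  Finset.sum_bij' (fun i _ => i.val) (fun i _ => (i : ZMod n))
    (fun i _ => Finset.mem_range.2 i.val_lt) (fun _ _ => Finset.mem_univ _)
    (fun i _ => i.natCast_zmod_val) (fun _ hi => ZMod.val_cast_of_lt (Finset.mem_range.1 hi))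
    fun i _ => by rw [i.natCast_zmod_val]

/-- The ring `R_n = ℤ[q] / (1 + q + ⋯ + q ^ (n - 1))`. -/
abbrev CyclicRing (n : ℕ) : Type :=
  Polynomial ℤ ⧸ Ideal.span {∑ i ∈ Finset.range n, (Polynomial.X : Polynomial ℤ) ^ i}

namespace CyclicRing

/-- The class of `q` in `R_n`. -/
noncomputable def root (n : ℕ) : CyclicRing n := Ideal.Quotient.mk _ Polynomial.X

theorem sum_root_pow (n : ℕ) : ∑ i ∈ Finset.range n, root n ^ i = 0 := by
  have h := Ideal.Quotient.eq_zero_iff_mem.2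
    (Ideal.mem_span_singleton_self (∑ i ∈ Finset.range n, (Polynomial.X : Polynomial ℤ) ^ i))
  rwa [map_sum, Finset.sum_congr rfl fun i _ => map_pow _ _ i] at h

theorem root_pow (n : ℕ) : root n ^ n = 1 := by
  rw [← sub_eq_zero, ← geom_sum_mul, sum_root_pow, zero_mul]

variable {n : ℕ} [NeZero n]

variable (n) in
/-- The powers of `q`, with exponents in `ℤ/n`. -/
noncomputable def rootChar : AddChar (ZMod n) (CyclicRing n) :=
  AddChar.zmodChar n (root_pow n)

theorem rootChar_natCast (i : ℕ) : rootChar n i = root n ^ i := AddChar.zmodChar_apply' _ i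

theorem sum_rootChar : ∑ i, rootChar n i = 0 := by
  simp only [sum_zmod_eq_sum_range, rootChar_natCast, sum_root_pow]

end CyclicRing

/-! ### Characters -/

namespace Taft

open FDMod CyclicRing

variable {k : Type u} [Field k] {n : ℕ} {ζ : k} {hn : 1 < n} {hζ : IsPrimitiveRoot ζ n}

theorem ρ_K_tensor (M N : FDMod k (TaftAlgebra hn hζ)) (x : M.carrier) (y : N.carrier) :
    (tensor M N).ρ (K hn hζ) (x ⊗ₜ[k] y) = M.ρ (K hn hζ) x ⊗ₜ[k] N.ρ (K hn hζ) y := by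
  change tensorAct M N (comul (R := k) (K hn hζ)) (x ⊗ₜ[k] y) = _
  rw [comul_K, tensorAct_tmul]

variable [NeZero n]

section Character

/-- The character `∑ i, m_i q ^ i` of a module, where `m_i` is the multiplicity of `ζ ^ i` as an
eigenvalue of `K`. -/
noncomputable def character (M : FDMod k (TaftAlgebra hn hζ)) : CyclicRing n :=
  ∑ i, mult M i • rootChar n i

theorem isAdditive_character :
    IsAdditive (character : FDMod k (TaftAlgebra hn hζ) → CyclicRing n) :=
  fun _ _ _ _ _ h => by
    simp only [character, isAdditive_mult _ h, add_smul, Finset.sum_add_distrib]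

theorem character_eq_zero_of_isProjective {P : FDMod k (TaftAlgebra hn hζ)}
    (hP : P.IsProjective) : character P = 0 := by
  rw [character, Finset.sum_congr rfl fun i _ => by rw [mult_eq_of_isProjective hP i 0],
    ← Finset.smul_sum, sum_rootChar, smul_zero]

theorem character_of_scalar {M : FDMod k (TaftAlgebra hn hζ)} {i : ZMod n}
    (h : ∀ x, M.ρ (K hn hζ) x = chi hζ i • x) :
    character M = Module.finrank k M.carrier • rootChar n i := by
  simp only [character, mult_of_scalar h, ite_smul, zero_smul, Finset.sum_ite_eq',
    Finset.mem_univ, if_true]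

theorem character_unit : character (unit k (TaftAlgebra hn hζ)) = 1 := by
  have hrank : Module.finrank k (unit k (TaftAlgebra hn hζ)).carrier = 1 := Module.finrank_self k
  rw [character_of_scalar (i := 0), hrank, one_smul, AddChar.map_zero_eq_one]
  intro c
  change counit (R := k) (K hn hζ) * (show k from c) = chi hζ 0 * (show k from c)
  rw [counit_K, AddChar.map_zero_eq_one]

theorem character_oneDim (i : ZMod n) : character (oneDim hn hζ i) = rootChar n i := by
  rw [character_of_scalar (ρ_K_oneDim i), finrank_oneDim, one_smul]

theorem character_oneDim_tensor (i j : ZMod n) :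
    character (tensor (oneDim hn hζ i) (oneDim hn hζ j)) =
      character (oneDim hn hζ i) * character (oneDim hn hζ j) := by
  have hK (x : (tensor (oneDim hn hζ i) (oneDim hn hζ j)).carrier) :
      (tensor (oneDim hn hζ i) (oneDim hn hζ j)).ρ (K hn hζ) x = chi hζ (i + j) • x := by
    refine LinearMap.congr_fun (TensorProduct.ext' fun a b => ?_ :
      _ = LinearMap.lsmul k ((oneDim hn hζ i).carrier ⊗[k] (oneDim hn hζ j).carrier)
        (chi hζ (i + j))) x
    refine (ρ_K_tensor _ _ a b).trans ?_
    rw [ρ_K_oneDim, ρ_K_oneDim, smul_tmul_smul, ← AddChar.map_add_eq_mul]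
    rfl
  have hrank : Module.finrank k (tensor (oneDim hn hζ i) (oneDim hn hζ j)).carrier = 1 :=
    (Module.finrank_tensorProduct (R := k) (S := k)).trans
      (by rw [finrank_oneDim, finrank_oneDim])
  rw [character_of_scalar hK, hrank, one_smul, character_oneDim, character_oneDim,
    AddChar.map_add_eq_mul]

theorem character_tensor (M N : FDMod k (TaftAlgebra hn hζ)) :
    character (tensor M N) = character M * character N := by
  have hleft : IsAdditive fun L : FDMod k (TaftAlgebra hn hζ) => character (tensor L N) :=
    fun _ _ _ _ _ h => isAdditive_character (h.tensor_right N)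
  have hleft' : IsAdditive fun L : FDMod k (TaftAlgebra hn hζ) => character L * character N :=
    fun _ _ _ _ _ h => by simp only [isAdditive_character h, add_mul]
  refine eq_of_eq_oneDim hleft hleft' (fun i => ?_) M
  have hright : IsAdditive fun L : FDMod k (TaftAlgebra hn hζ) =>
      character (tensor (oneDim hn hζ i) L) :=
    fun _ _ _ _ _ h => isAdditive_character (h.tensor_left _)
  have hright' : IsAdditive fun L : FDMod k (TaftAlgebra hn hζ) =>
      character (oneDim hn hζ i) * character L :=
    fun _ _ _ _ _ h => by simp only [isAdditive_character h, mul_add]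
  exact eq_of_eq_oneDim hright hright' (character_oneDim_tensor i) N

end Character

section Isomorphism

variable (Λ : LeftIntegral k (TaftAlgebra hn hζ))

theorem cls_eq_sum (M : FDMod k (TaftAlgebra hn hζ)) :
    StMod.cls Λ (StMod.of M) = ∑ i, mult M i • StMod.cls Λ (StMod.of (oneDim hn hζ i)) := by
  refine eq_of_eq_oneDim (StMod.isAdditive_cls Λ)
    (χ' := fun M => ∑ i, mult M i • StMod.cls Λ (StMod.of (oneDim hn hζ i)))
    (fun _ _ _ _ _ h => ?_) (fun i => ?_) M
  · simp only [isAdditive_mult _ h, add_smul, Finset.sum_add_distrib]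
  · simp only [mult_oneDim, ite_smul, one_smul, zero_smul, Finset.sum_ite_eq', Finset.mem_univ,
      if_true]

theorem sum_cls_oneDim : ∑ i, StMod.cls Λ (StMod.of (oneDim hn hζ i)) = 0 := by
  rw [← StMod.cls_eq_zero_of_isProjective Λ (isProjective_stringMod 0), cls_eq_sum]
  simp only [mult_stringMod_zero, one_smul]

/-- The homomorphism from the Grothendieck group to `R_n` induced by the character. -/
noncomputable def characterHom : StMod.GrothendieckGroup Λ →+ CyclicRing n :=
  StMod.lift character isAdditive_character fun _ => character_eq_zero_of_isProjective

theorem characterHom_cls (M : StMod k (TaftAlgebra hn hζ)) :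
    characterHom Λ (StMod.cls Λ M) = character M.as :=
  StMod.lift_cls _ _ M

/-- The homomorphism from polynomials to the Grothendieck group that sends `q ^ i` to the class of
the one-dimensional module on which `K` acts by `ζ ^ i`. -/
noncomputable def polyHom : Polynomial ℤ →ₗ[ℤ] StMod.GrothendieckGroup Λ :=
  (Polynomial.basisMonomials ℤ).constr ℤ
    fun i : ℕ => StMod.cls Λ (StMod.of (oneDim hn hζ (i : ZMod n)))

theorem polyHom_X_pow (i : ℕ) :
    polyHom Λ (Polynomial.X ^ i) = StMod.cls Λ (StMod.of (oneDim hn hζ (i : ZMod n))) := by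
  have hX : Polynomial.X ^ i = Polynomial.basisMonomials ℤ i := by
    rw [Polynomial.coe_basisMonomials]
    exact (Polynomial.monomial_one_right_eq_X_pow i).symm
  rw [hX, polyHom, Module.Basis.constr_basis]

theorem polyHom_mul_geomSum (p : Polynomial ℤ) :
    polyHom Λ (p * ∑ i ∈ Finset.range n, Polynomial.X ^ i) = 0 := by
  induction p using Polynomial.induction_on' with
  | add p q hp hq => rw [add_mul, map_add, hp, hq, add_zero]
  | monomial a c =>
    rw [← Polynomial.smul_X_eq_monomial, smul_mul_assoc, map_smul, Finset.mul_sum, map_sum]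
    simp only [← pow_add, polyHom_X_pow, Nat.cast_add]
    have hsum : ∑ i : ZMod n, StMod.cls Λ (StMod.of (oneDim hn hζ (a + i))) = 0 :=
      (Equiv.sum_comp (Equiv.addLeft (a : ZMod n)) _).trans (sum_cls_oneDim Λ)
    rw [← sum_zmod_eq_sum_range fun i : ZMod n => StMod.cls Λ (StMod.of (oneDim hn hζ (a + i))),
      hsum, smul_zero]

theorem characterHom_polyHom (p : Polynomial ℤ) :
    characterHom Λ (polyHom Λ p) = Ideal.Quotient.mk _ p := by
  induction p using Polynomial.induction_on' with
  | add p q hp hq => rw [map_add, map_add, map_add, hp, hq]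
  | monomial a c =>
    rw [← Polynomial.smul_X_eq_monomial, map_smul, map_zsmul, polyHom_X_pow, characterHom_cls,
      character_oneDim, rootChar_natCast, map_zsmul, map_pow, root]

theorem polyHom_surjective : Function.Surjective (polyHom Λ) := by
  refine StMod.mem_of_cls_mem (polyHom Λ).toAddMonoidHom.range fun M => ?_
  refine ⟨∑ i : ZMod n, mult M.as i • Polynomial.X ^ i.val, ?_⟩
  refine Eq.trans ?_ (cls_eq_sum Λ M.as).symm
  refine (map_sum (polyHom Λ) _ _).trans (Finset.sum_congr rfl fun i _ => ?_)
  rw [map_nsmul, polyHom_X_pow, ZMod.natCast_zmod_val]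

theorem characterHom_bijective : Function.Bijective (characterHom Λ) := by
  refine ⟨(injective_iff_map_eq_zero _).2 fun x hx => ?_, fun y => ?_⟩
  · obtain ⟨p, rfl⟩ := polyHom_surjective Λ x
    rw [characterHom_polyHom, Ideal.Quotient.eq_zero_iff_mem] at hx
    obtain ⟨c, rfl⟩ := Ideal.mem_span_singleton'.1 hx
    exact polyHom_mul_geomSum Λ c
  · obtain ⟨p, rfl⟩ := Ideal.Quotient.mk_surjective y
    exact ⟨polyHom Λ p, characterHom_polyHom Λ p⟩

/-- The character, as an isomorphism from the Grothendieck group to `R_n`. -/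
noncomputable def characterEquiv : StMod.GrothendieckGroup Λ ≃+ CyclicRing n :=
  AddEquiv.ofBijective (characterHom Λ) (characterHom_bijective Λ)

theorem characterEquiv_cls (M : StMod k (TaftAlgebra hn hζ)) :
    characterEquiv Λ (StMod.cls Λ M) = character M.as :=
  characterHom_cls Λ M

/-- The ring structure on the Grothendieck group carried over from `R_n`. -/
noncomputable abbrev grothendieckRing : Ring (StMod.GrothendieckGroup Λ) :=
  (characterEquiv Λ).toEquiv.ring

theorem isGrothendieckRing : StMod.IsGrothendieckRing Λ (grothendieckRing Λ) where
  add_eq x y := by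
    change (characterEquiv Λ).symm (characterEquiv Λ x + characterEquiv Λ y) = x + y
    rw [← map_add, AddEquiv.symm_apply_apply]
  one_eq := by
    change (characterEquiv Λ).symm 1 = _
    rw [AddEquiv.symm_apply_eq, characterEquiv_cls]
    exact character_unit.symm
  mul_eq M N := by
    change (characterEquiv Λ).symm (characterEquiv Λ _ * characterEquiv Λ _) = _
    rw [AddEquiv.symm_apply_eq, characterEquiv_cls, characterEquiv_cls, characterEquiv_cls]
    exact (character_tensor M N).symm

end Isomorphism

end Taft

theorem mainTheorem8_general {k : Type u} [Field k] {n : ℕ} (hn : 1 < n) {ζ : k}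
    (hζ : IsPrimitiveRoot ζ n) (Λ : LeftIntegral k (TaftAlgebra hn hζ)) :
    (∃! r : Ring (StMod.GrothendieckGroup Λ), StMod.IsGrothendieckRing Λ r) ∧
    ∀ r : Ring (StMod.GrothendieckGroup Λ), StMod.IsGrothendieckRing Λ r →
      Nonempty (StMod.GrothendieckGroup Λ ≃+*
        (Polynomial ℤ ⧸ Ideal.span {∑ i ∈ Finset.range n, (Polynomial.X : Polynomial ℤ) ^ i})) := by
  have : NeZero n := ⟨(zero_lt_one.trans hn).ne'⟩
  have hr := Taft.isGrothendieckRing Λ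
  refine ⟨⟨_, hr, fun r h => h.unique hr⟩, fun r h => ?_⟩
  obtain rfl := h.unique hr
  exact ⟨(Taft.characterEquiv Λ).toEquiv.ringEquiv⟩

theorem mainTheorem8 {k : Type u} [Field k] [CharZero k] {n : ℕ} (hn : 1 < n) {ζ : k}
    (hζ : IsPrimitiveRoot ζ n) (Λ : LeftIntegral k (TaftAlgebra hn hζ)) :
    (∃! r : Ring (StMod.GrothendieckGroup Λ), StMod.IsGrothendieckRing Λ r) ∧
    ∀ r : Ring (StMod.GrothendieckGroup Λ), StMod.IsGrothendieckRing Λ r →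
      Nonempty (StMod.GrothendieckGroup Λ ≃+*
        (Polynomial ℤ ⧸ Ideal.span {∑ i ∈ Finset.range n, (Polynomial.X : Polynomial ℤ) ^ i})) :=
  mainTheorem8_general hn hζ Λ
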